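/- Graphs are finite with nonempty vertex set and may have loops and multiple edges. The degree $d_G(v)$ counts each loop at $v$ twice. A graph $G$ is $k$-edge-connected if, for every nonempty proper subset $A$ of $V(G)$, at least $k$ edges of $G$ have exactly one end in $A$. A factor of $G$ is a spanning subgraph $H$ of $G$; its complement is $G\setminus E(H)$, the factor with edge set $E(G)\setminus E(H)$. A graph is $m$-tree-connected if it contains $m$ pairwise edge-disjoint spanning trees (so every graph is $0$-tree-connected). Theorem. Let $m,m_0$ be nonnegative integers with $m+m_0>0$, and let $G$ be a $(2m+2m_0)$-edge-connected graph. Then $G$ has an $m$-tree-connected factor $H$ such that its complement $G\setminus E(H)$ is $m_0$-tree-connected and, for each vertex $v$, $$\Big\lfloor\frac{d_G(v)}{2}\Big\rfloor-m_0\le d_H(v)\le \Big\lceil\frac{d_G(v)}{2}\Big\rceil+m.$$ Furthermore, if $G$ has at least two vertices, then for every vertex $z$ and every integer $t$ with $\lfloor d_G(z)/2\rfloor-m_0\le t\le\lceil d_G(z)/2\rceil+m$, there is such a factor $H$ with $d_H(z)=t$. -/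

import Mathlib

open scoped Graph

namespace Graph

/-- The degree of a vertex of a multigraph: the number of incident edges, each loop counting
twice. -/
noncomputable def degree {α β : Type*} (G : Graph α β) (v : α) : ℕ :=
  (G.incidenceSet v).ncard + (G.loopSet v).ncard

/-- The edges of `G` with exactly one end in `A`. -/
def edgeCut {α β : Type*} (G : Graph α β) (A : Set α) : Set β :=
  {e | ∃ x ∈ A, ∃ y ∉ A, G.IsLink e x y}

/-- `G` is `k`-edge-connected: at least `k` edges leave every nonempty proper subset of the
vertex set. -/
def IsEdgeConnected {α β : Type*} (G : Graph α β) (k : ℕ) : Prop :=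
  ∀ A : Set α, A.Nonempty → A ⊂ V(G) → k ≤ (G.edgeCut A).ncard

/-- `G` is connected: it has a vertex, and any two of its vertices are joined by a walk. -/
def IsConnected {α β : Type*} (G : Graph α β) : Prop :=
  V(G).Nonempty ∧ ∀ x ∈ V(G), ∀ y ∈ V(G), Relation.ReflTransGen G.Adj x y

/-- `G` has no cycle. A cycle of length `n + 1` consists of distinct vertices
`v 0, …, v n` and distinct edges `e 0, …, e n` such that `e i` joins `v i` to `v (i + 1)`, with
indices taken modulo `n + 1`; so a loop is a cycle of length 1, and two parallel edges form a
cycle of length 2. -/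
def IsAcyclic {α β : Type*} (G : Graph α β) : Prop :=
  ∀ (n : ℕ) (v : Fin (n + 1) → α) (e : Fin (n + 1) → β),
    Function.Injective v → Function.Injective e → ¬ ∀ i, G.IsLink (e i) (v i) (v (i + 1))

/-- A tree is a connected graph without cycles. -/
def IsTree {α β : Type*} (G : Graph α β) : Prop :=
  G.IsConnected ∧ G.IsAcyclic

/-- `G` is `m`-tree-connected: it contains `m` pairwise edge-disjoint spanning trees. -/
def IsTreeConnected {α β : Type*} (G : Graph α β) (m : ℕ) : Prop :=
  ∃ T : Fin m → Graph α β, (∀ i, T i ≤s G ∧ (T i).IsTree) ∧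
    ∀ i j, i ≠ j → Disjoint E(T i) E(T j)

/-- `H` is an `m`-tree-connected factor (spanning subgraph) of `G` whose complement
`G \ E(H)` is `m₀`-tree-connected, and `⌊d_G(v)/2⌋ - m₀ ≤ d_H(v) ≤ ⌈d_G(v)/2⌉ + m` for every
vertex `v`. -/
def IsBoundedTreeConnectedFactor {α β : Type*} (G H : Graph α β) (m m₀ : ℕ) : Prop :=
  H ≤s G ∧ H.IsTreeConnected m ∧ (G.deleteEdges E(H)).IsTreeConnected m₀ ∧
    ∀ v ∈ V(G), ⌊(G.degree v : ℚ) / 2⌋ - (m₀ : ℤ) ≤ (H.degree v : ℤ) ∧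
      (H.degree v : ℤ) ≤ ⌈(G.degree v : ℚ) / 2⌉ + (m : ℤ)

end Graph

/-!
Write `k = m + m₀` and let `d` be the degree function of `G`. Vertices and edges are finite sets
`V`, `E`, and the two functions `s t : β → α` give the ends of the edges; reading `s` as tail and
`t` as head makes them an orientation. Loops are put aside until the end.

*Orientation.* `G` has an orientation in which every out-degree is at most `⌈d(v)/2⌉`, that of a
root `z` is at most `⌊d(z)/2⌋`, and every nonempty vertex set avoiding `z` is entered by at least
`k` arcs (`exists_rooted_orientation`). By Hall's theorem it is enough to find an in-degree vector
`μ ≥ ⌊d/2⌋` (at `z`: `⌈d/2⌉`) of total `|E|` such that `μ(X)` is at least the number of edges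
inside `X`, plus `k` if `z ∉ X`. A minimal vector satisfying these lower bounds has the right total:
the demand is supermodular on intersecting sets, so `V` splits into maximal tight sets and single
vertices with `μ(v) ≤ (d(v) + [v = z]) / 2`, and on a tight set `X` edge-connectivity gives
`2 μ(X) ≤ ∑_{v ∈ X} d(v)`.

*Arborescences.* By Edmonds' theorem (`exists_disjoint_spanning_arbs`) the orientation contains `k`
disjoint spanning arborescences with root `z`. Let `T` be the union of `m` of them, `M` that of
the other `m₀`, and `R` the set of remaining arcs. Since all in-degrees in an arborescence are at
most one, the degrees of `T` and `M` at `v` are at most `⌈d(v)/2⌉ + m` and `⌈d(v)/2⌉ + m₀`.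

*Factor.* It remains to choose `F ⊆ R` such that `H = T ∪ F` has its degrees in the required
windows `[l + d_T, u + d_T]`. In terms of `R`, one has `out_R ≤ u` and `l ≤ in_R` at every vertex,
and the windows have positive length. These inequalities suffice: starting from `F = R`, the degree
at a vertex above its window can be lowered along an alternating path, since otherwise the vertices
reached by alternating paths would violate a count of the arcs by their tails
(`exists_lower_deg`). At `z` even an exact degree can be prescribed, because each arborescence
uses an arc leaving `z` and the out-degree of `z` was rounded down (`exists_isSplit_of_loopless`).

*Loops.* Adding a loop at `v` moves the window of `v` by one, and putting the loop in `H` or in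
the complement moves the degree by `1` or `-1` relative to the window; as `k > 0` makes the windows
nontrivial, one of the two choices is admissible (`exists_isSplit_union_loops_eq`).
-/

namespace MultiArc

/-! ### Disjoint spanning arborescences -/

section Arborescences

variable {α β : Type*} [DecidableEq α]

/-- The degree of `v` in the edge set `F`, where `s` and `t` give the ends of an edge; a loop counts
twice. -/
def deg (s t : β → α) (F : Finset β) (v : α) : ℕ :=
  (F.filter fun e => s e = v).card + (F.filter fun e => t e = v).card

/-- The arcs of `F` that enter `X`, when `e` is directed from `s e` to `t e`. -/
def inArcs (s t : β → α) (F : Finset β) (X : Finset α) : Finset β :=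
  F.filter fun e => t e ∈ X ∧ s e ∉ X

/-- The edges of `F` with both ends in `X`. -/
def inner (s t : β → α) (F : Finset β) (X : Finset α) : Finset β :=
  F.filter fun e => s e ∈ X ∧ t e ∈ X

lemma card_inArcs_submodular (s t : β → α) (F : Finset β) (X Y : Finset α) :
    (inArcs s t F (X ∩ Y)).card + (inArcs s t F (X ∪ Y)).card ≤
      (inArcs s t F X).card + (inArcs s t F Y).card := by
  simp only [inArcs, Finset.card_filter, ← Finset.sum_add_distrib, Finset.mem_inter,
    Finset.mem_union]
  refine Finset.sum_le_sum fun e _ => ?_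
  by_cases h1 : s e ∈ X <;> by_cases h2 : s e ∈ Y <;> by_cases h3 : t e ∈ X <;>
    by_cases h4 : t e ∈ Y <;> simp [h1, h2, h3, h4]

lemma card_inner_supermodular (s t : β → α) (F : Finset β) (X Y : Finset α) :
    (inner s t F X).card + (inner s t F Y).card ≤
      (inner s t F (X ∩ Y)).card + (inner s t F (X ∪ Y)).card := by
  simp only [inner, Finset.card_filter, ← Finset.sum_add_distrib, Finset.mem_inter,
    Finset.mem_union]
  refine Finset.sum_le_sum fun e _ => ?_
  by_cases h1 : s e ∈ X <;> by_cases h2 : s e ∈ Y <;> by_cases h3 : t e ∈ X <;>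
    by_cases h4 : t e ∈ Y <;> simp [h1, h2, h3, h4]

variable [DecidableEq β]

/-- `Arb s t z U A`: the arcs `A` form an out-arborescence with root `z` and vertex set `U`. It is
grown from the single vertex `z` by adding arcs from a vertex reached to a new vertex. -/
inductive Arb (s t : β → α) (z : α) : Finset α → Finset β → Prop
  | single : Arb s t z {z} ∅
  | step {U : Finset α} {A : Finset β} (e : β) : Arb s t z U A → s e ∈ U → t e ∉ U →
      Arb s t z (insert (t e) U) (insert e A)

namespace Arb

variable {s t : β → α} {z : α} {U : Finset α} {A : Finset β}

lemma root_mem (h : Arb s t z U A) : z ∈ U := by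
  induction h with
  | single => simp
  | step e _ _ _ ih => exact Finset.mem_insert_of_mem ih

lemma ends_mem (h : Arb s t z U A) : ∀ e ∈ A, s e ∈ U ∧ t e ∈ U := by
  induction h with
  | single => simp
  | step e _ hs _ ih =>
    intro f hf
    rcases Finset.mem_insert.1 hf with rfl | hf
    · exact ⟨Finset.mem_insert_of_mem hs, Finset.mem_insert_self _ _⟩
    · exact ⟨Finset.mem_insert_of_mem (ih f hf).1, Finset.mem_insert_of_mem (ih f hf).2⟩

lemma card_filter_head (h : Arb s t z U A) :
    ∀ v ∈ U, (A.filter fun e => t e = v).card = if v = z then 0 else 1 := by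
  induction h with
  | single => intro v hv; simpa using hv
  | @step U A e hA hs ht ih =>
    intro v hv
    have heA : e ∉ A := fun he => ht (hA.ends_mem e he).2
    by_cases hve : t e = v
    · subst hve
      have h0 : (A.filter fun f => t f = t e) = ∅ := by
        refine Finset.filter_eq_empty_iff.2 fun f hf hfe => ht ?_
        rw [← hfe]; exact (hA.ends_mem f hf).2
      have hz : t e ≠ z := fun h => ht (h ▸ hA.root_mem)
      rw [Finset.filter_insert, if_pos rfl, h0]
      simp [hz]
    · have hvU : v ∈ U := (Finset.mem_insert.1 hv).resolve_left fun h => hve h.symm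
      rw [Finset.filter_insert, if_neg hve, ih v hvU]

lemma reflTransGen (h : Arb s t z U A) : ∀ v ∈ U,
    Relation.ReflTransGen (fun x y => ∃ e ∈ A, s e = x ∧ t e = y) z v := by
  induction h with
  | single => intro v hv; rw [Finset.mem_singleton.1 hv]
  | @step U A e hA hs ht ih =>
    have hmono : ∀ v ∈ U,
        Relation.ReflTransGen (fun x y => ∃ f ∈ insert e A, s f = x ∧ t f = y) z v :=
      fun v hv => Relation.ReflTransGen.mono
        (fun x y (hxy : ∃ f ∈ A, s f = x ∧ t f = y) =>
          hxy.imp fun f hf => ⟨Finset.mem_insert_of_mem hf.1, hf.2⟩) _ _ (ih v hv)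
    intro v hv
    rcases Finset.mem_insert.1 hv with rfl | hv
    · exact (hmono _ hs).tail ⟨e, Finset.mem_insert_self _ _, rfl, rfl⟩
    · exact hmono v hv

/-- An arborescence has no undirected cycle, in the form used by `Graph.IsAcyclic`: a cycle through
the arc added last would have to use that arc twice, as it is the only one at its head. -/
lemma acyclic (h : Arb s t z U A) (n : ℕ) (v : Fin (n + 1) → α) (c : Fin (n + 1) → β)
    (hc : Function.Injective c) (hcA : ∀ i, c i ∈ A)
    (hl : ∀ i, (s (c i) = v i ∧ t (c i) = v (i + 1)) ∨ (s (c i) = v (i + 1) ∧ t (c i) = v i)) :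
    False := by
  induction h with
  | single => exact absurd (hcA 0) (by simp)
  | @step U A e hA hs ht ih =>
    refine ih fun i => (Finset.mem_insert.1 (hcA i)).resolve_left fun hi => ?_
    have key : ∀ j, v j = t e → c j = e := fun j hj => by
      refine (Finset.mem_insert.1 (hcA j)).resolve_right fun hjA => ht ?_
      rcases hl j with h | h
      · rw [← hj, ← h.1]; exact (hA.ends_mem _ hjA).1
      · rw [← hj, ← h.2]; exact (hA.ends_mem _ hjA).2
    have key' : ∀ j, v (j + 1) = t e → c j = e := fun j hj => by
      refine (Finset.mem_insert.1 (hcA j)).resolve_right fun hjA => ht ?_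
      rcases hl j with h | h
      · rw [← hj, ← h.2]; exact (hA.ends_mem _ hjA).2
      · rw [← hj, ← h.1]; exact (hA.ends_mem _ hjA).1
    have hst : s e ≠ t e := fun h => ht (h ▸ hs)
    rcases hl i with h | h
    · have h1 : c (i + 1) = e := key _ (by rw [← h.2, hi])
      have h2 : i + 1 = i := hc (h1.trans hi.symm)
      rw [h2, hi] at h
      exact hst (h.1.trans h.2.symm)
    · have h1 : v (i - 1 + 1) = t e := by rw [sub_add_cancel, ← h.2, hi]
      have h2 : i - 1 = i := hc ((key' _ h1).trans hi.symm)
      rw [h2] at h1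
      rw [hi] at h
      exact hst (h.1.trans h1)

end Arb

/-- Lovász's step for Edmonds' theorem: a partial arborescence whose removal leaves every set
avoiding the root with `k` entering arcs can be enlarged so that this remains true. -/
lemma exists_arb_step {V : Finset α} {E : Finset β} {s t : β → α} {z : α}
    {k : ℕ} (hE : ∀ e ∈ E, s e ∈ V)
    (hk : ∀ X ⊆ V, z ∉ X → X.Nonempty → k + 1 ≤ (inArcs s t E X).card)
    {U : Finset α} {A : Finset β} (hA : Arb s t z U A) (hUV : U ⊂ V)
    (hAk : ∀ X ⊆ V, z ∉ X → X.Nonempty → k ≤ (inArcs s t (E \ A) X).card) :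
    ∃ e ∈ E \ A, s e ∈ U ∧ t e ∈ V ∧ t e ∉ U ∧
      ∀ X ⊆ V, z ∉ X → X.Nonempty → k ≤ (inArcs s t (E \ insert e A) X).card := by
  have hout : ∀ X : Finset α, inArcs s t (E \ A) (X \ U) = inArcs s t E (X \ U) := by
    intro X
    ext e
    simp only [inArcs, Finset.mem_filter, Finset.mem_sdiff]
    refine ⟨fun h => ⟨h.1.1, h.2⟩, fun h => ⟨⟨h.1, fun he => h.2.1.2 (hA.ends_mem e he).2⟩, h.2⟩⟩
  -- removing an arc costs at most one, and only at the sets that it enters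
  have hdel : ∀ e, ∀ X, (¬ (t e ∈ X ∧ s e ∉ X) ∨ k + 1 ≤ (inArcs s t (E \ A) X).card) →
      k ≤ (inArcs s t (E \ A) X).card → k ≤ (inArcs s t (E \ insert e A) X).card := by
    intro e X h h'
    have heq : inArcs s t (E \ insert e A) X = (inArcs s t (E \ A) X).erase e := by
      ext f
      simp only [inArcs, Finset.mem_filter, Finset.mem_sdiff, Finset.mem_insert, Finset.mem_erase]
      tauto
    rw [heq]
    rcases h with h | h
    · rwa [Finset.erase_eq_of_notMem]
      simp only [inArcs, Finset.mem_filter]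
      tauto
    · have := Finset.pred_card_le_card_erase (s := inArcs s t (E \ A) X) (a := e)
      omega
  have hVU : (V \ U).Nonempty := Finset.sdiff_nonempty.2 hUV.2
  -- an arc into `X \ U` from inside a minimal tight set `X` not contained in `U` enters no tight
  -- set `Y`, for `X ∩ Y` would be a smaller such set
  by_cases hex : ∃ X ⊆ V, z ∉ X ∧ (X \ U).Nonempty ∧ (inArcs s t (E \ A) X).card = k
  · obtain ⟨X, ⟨hXV, hzX, hXU, hXk⟩, hmin⟩ := exists_minimal_of_wellFoundedLT
      (fun X : Finset α => X ⊆ V ∧ z ∉ X ∧ (X \ U).Nonempty ∧ (inArcs s t (E \ A) X).card = k) hex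
    have h1 : k + 1 ≤ (inArcs s t (E \ A) (X \ U)).card := by
      rw [hout]
      exact hk _ (Finset.sdiff_subset.trans hXV) (fun h => hzX (Finset.sdiff_subset h)) hXU
    obtain ⟨e, he, heX⟩ : ∃ e ∈ inArcs s t (E \ A) (X \ U), e ∉ inArcs s t (E \ A) X := by
      by_contra! h
      have := Finset.card_le_card h
      omega
    simp only [inArcs, Finset.mem_filter, Finset.mem_sdiff] at he heX
    have htX := he.2.1.1
    have htU := he.2.1.2
    have hsX : s e ∈ X := by
      by_contra h; exact heX ⟨he.1, htX, h⟩
    have hsU : s e ∈ U := by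
      by_contra h; exact he.2.2 ⟨hsX, h⟩
    refine ⟨e, Finset.mem_sdiff.2 he.1, hsU, hXV htX, htU, fun Y hYV hzY hY => ?_⟩
    refine hdel e Y ?_ (hAk Y hYV hzY hY)
    by_contra! hcon
    obtain ⟨⟨htY, hsY⟩, hYk⟩ := hcon
    have h2 := card_inArcs_submodular s t (E \ A) X Y
    have h3 := hAk (X ∪ Y) (Finset.union_subset hXV hYV) (by simp [hzX, hzY])
      ⟨t e, by simp [htY]⟩
    have h4 := hAk (X ∩ Y) (Finset.inter_subset_left.trans hXV) (by simp [hzX])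
      ⟨t e, by simp [htY, htX]⟩
    have h5 := hmin (y := X ∩ Y) ⟨Finset.inter_subset_left.trans hXV, by simp [hzX],
      ⟨t e, by simp [htY, htX, htU]⟩, by omega⟩ Finset.inter_subset_left
    exact hsY (Finset.mem_inter.1 (h5 hsX)).2
  · have h1 : k + 1 ≤ (inArcs s t (E \ A) (V \ U)).card := by
      rw [hout]
      exact hk _ Finset.sdiff_subset (by simp [hA.root_mem]) hVU
    obtain ⟨e, he⟩ := Finset.card_pos.1 (show 0 < (inArcs s t (E \ A) (V \ U)).card by omega)
    simp only [inArcs, Finset.mem_filter] at he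
    have htV := Finset.mem_sdiff.1 he.2.1
    have hsU : s e ∈ U := by
      by_contra h
      exact he.2.2 (Finset.mem_sdiff.2 ⟨hE e (Finset.mem_sdiff.1 he.1).1, h⟩)
    refine ⟨e, he.1, hsU, htV.1, htV.2, fun Y hYV hzY hY => ?_⟩
    refine hdel e Y ?_ (hAk Y hYV hzY hY)
    by_contra! hcon
    have := hAk Y hYV hzY hY
    exact hex ⟨Y, hYV, hzY, ⟨t e, Finset.mem_sdiff.2 ⟨hcon.1.1, htV.2⟩⟩, by omega⟩

lemma exists_spanning_arb {V : Finset α} {E : Finset β} {s t : β → α} {z : α} (hz : z ∈ V)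
    {k : ℕ} (hE : ∀ e ∈ E, s e ∈ V)
    (hk : ∀ X ⊆ V, z ∉ X → X.Nonempty → k + 1 ≤ (inArcs s t E X).card) :
    ∃ A ⊆ E, Arb s t z V A ∧
      ∀ X ⊆ V, z ∉ X → X.Nonempty → k ≤ (inArcs s t (E \ A) X).card := by
  suffices H : ∀ n : ℕ, ∀ U A, (V \ U).card = n → U ⊆ V → Arb s t z U A → A ⊆ E →
      (∀ X ⊆ V, z ∉ X → X.Nonempty → k ≤ (inArcs s t (E \ A) X).card) →
      ∃ A ⊆ E, Arb s t z V A ∧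
        ∀ X ⊆ V, z ∉ X → X.Nonempty → k ≤ (inArcs s t (E \ A) X).card from
    H _ {z} ∅ rfl (by simpa) Arb.single (by simp) fun X h1 h2 h3 => by
      simpa using (Nat.le_succ k).trans (hk X h1 h2 h3)
  intro n
  induction n with
  | zero =>
    intro U A hn hUV hA hAE hAk
    have : U = V := hUV.antisymm (Finset.sdiff_eq_empty_iff_subset.1 (Finset.card_eq_zero.1 hn))
    exact ⟨A, hAE, this ▸ hA, hAk⟩
  | succ n ih =>
    intro U A hn hUV hA hAE hAk
    have hss : U ⊂ V := by
      refine hUV.ssubset_of_ne fun h => ?_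
      simp [h] at hn
    obtain ⟨e, he, hs, htV, htU, h⟩ := exists_arb_step hE hk hA hss hAk
    refine ih (insert (t e) U) (insert e A) ?_ (Finset.insert_subset htV hUV)
      (hA.step e hs htU) (Finset.insert_subset (Finset.mem_sdiff.1 he).1 hAE) h
    have : V \ insert (t e) U = (V \ U).erase (t e) := by
      ext x; simp only [Finset.mem_sdiff, Finset.mem_insert, Finset.mem_erase]; tauto
    rw [this, Finset.card_erase_of_mem (by simp [htV, htU]), hn]; rfl

/-- Edmonds' disjoint arborescences theorem: if every nonempty set avoiding `z` is entered by at
least `k` arcs, there are `k` disjoint spanning arborescences with root `z`. -/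
theorem exists_disjoint_spanning_arbs {V : Finset α} {s t : β → α} {z : α} (hz : z ∈ V)
    (k : ℕ) {E : Finset β} (hE : ∀ e ∈ E, s e ∈ V)
    (hk : ∀ X ⊆ V, z ∉ X → X.Nonempty → k ≤ (inArcs s t E X).card) :
    ∃ A : Fin k → Finset β, (∀ i, A i ⊆ E ∧ Arb s t z V (A i)) ∧
      ∀ i j, i ≠ j → Disjoint (A i) (A j) := by
  induction k generalizing E with
  | zero => exact ⟨fun _ => ∅, fun i => i.elim0, fun i => i.elim0⟩
  | succ k ih =>
    obtain ⟨B, hBE, hB, hBk⟩ := exists_spanning_arb hz hE hk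
    obtain ⟨A, hA, hdis⟩ := ih (E := E \ B) (fun e he => hE e (Finset.mem_sdiff.1 he).1) hBk
    have hAB : ∀ i, Disjoint (A i) B := fun i =>
      Finset.disjoint_of_subset_left (hA i).1 Finset.sdiff_disjoint
    refine ⟨Fin.cons B A, fun i => ?_, fun i j => ?_⟩
    · refine Fin.cases ?_ (fun i => ?_) i
      · exact ⟨hBE, hB⟩
      · exact ⟨(hA i).1.trans Finset.sdiff_subset, (hA i).2⟩
    · refine Fin.cases ?_ (fun i => ?_) i <;> refine Fin.cases ?_ (fun j => ?_) j
      · exact fun h => absurd rfl h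
      · exact fun _ => (hAB j).symm
      · exact fun _ => hAB i
      · exact fun h => hdis i j fun h' => h (by rw [h'])

end Arborescences

/-! ### Orientations with rooted connectivity and balanced out-degrees -/

section Orientation

variable {α β : Type*} [DecidableEq α]

/-- The edges of `F` with exactly one end in `X`. -/
def crossing (s t : β → α) (F : Finset β) (X : Finset α) : Finset β :=
  F.filter fun e => ¬ (s e ∈ X ↔ t e ∈ X)

lemma sum_card_filter_eq (f : β → α) (F : Finset β) (X : Finset α) :
    ∑ v ∈ X, (F.filter fun e => f e = v).card = (F.filter fun e => f e ∈ X).card := by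
  simp only [Finset.card_filter]
  rw [Finset.sum_comm]
  simp

lemma sum_deg (s t : β → α) (F : Finset β) (X : Finset α) :
    ∑ v ∈ X, deg s t F v = 2 * (inner s t F X).card + (crossing s t F X).card := by
  simp only [deg, Finset.sum_add_distrib, sum_card_filter_eq]
  simp only [inner, crossing, Finset.card_filter, Finset.mul_sum, ← Finset.sum_add_distrib]
  refine Finset.sum_congr rfl fun e _ => ?_
  by_cases h1 : s e ∈ X <;> by_cases h2 : t e ∈ X <;> simp [h1, h2]

lemma sum_card_head (s t : β → α) (F : Finset β) (X : Finset α) :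
    ∑ v ∈ X, (F.filter fun e => t e = v).card =
      (inner s t F X).card + (inArcs s t F X).card := by
  rw [sum_card_filter_eq]
  simp only [inner, inArcs, Finset.card_filter, ← Finset.sum_add_distrib]
  refine Finset.sum_congr rfl fun e _ => ?_
  by_cases h1 : s e ∈ X <;> by_cases h2 : t e ∈ X <;> simp [h1, h2]

lemma inner_eq_self {s t : β → α} {F : Finset β} {X : Finset α}
    (h : ∀ e ∈ F, s e ∈ X ∧ t e ∈ X) : inner s t F X = F :=
  Finset.filter_true_of_mem h

/-- The least total in-degree of `X` in an orientation for which at least `k` arcs enter `X`, if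
`z ∉ X`. -/
def demand (s t : β → α) (F : Finset β) (z : α) (k : ℕ) (X : Finset α) : ℕ :=
  (inner s t F X).card + if z ∈ X then 0 else k

/-- This holds for disjoint `X` and `Y` as well only because the formula gives the empty set the
value `k`; the empty set has in-degree `0`, so tight sets are uncrossed only when they intersect. -/
lemma demand_supermodular (s t : β → α) (F : Finset β) (z : α) (k : ℕ) (X Y : Finset α) :
    demand s t F z k X + demand s t F z k Y ≤
      demand s t F z k (X ∩ Y) + demand s t F z k (X ∪ Y) := by
  have h := card_inner_supermodular s t F X Y
  unfold demand
  by_cases h1 : z ∈ X <;> by_cases h2 : z ∈ Y <;> simp [h1, h2] <;> omega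

/-- If every vertex has `2 μ(v) ≤ d(v) + [v = z]` or lies in a tight set, then
`2 μ(V) ≤ ∑ d + 1`: maximal tight sets are disjoint and satisfy `2 μ(X) ≤ ∑_{v ∈ X} d(v)`, so the
bound adds up over the pieces. -/
lemma two_mul_sum_le_of_tight {V : Finset α} {E : Finset β} {s t : β → α} {z : α} {k : ℕ}
    {μ : α → ℕ}
    (hk : ∀ X ⊆ V, z ∉ X → X.Nonempty → 2 * k ≤ (crossing s t E X).card)
    (hμ : ∀ X ⊆ V, X.Nonempty → demand s t E z k X ≤ ∑ v ∈ X, μ v)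
    (htight : ∀ v ∈ V, 2 * μ v ≤ deg s t E v + (if v = z then 1 else 0) ∨
      ∃ X ⊆ V, v ∈ X ∧ ∑ x ∈ X, μ x = demand s t E z k X) :
    2 * ∑ v ∈ V, μ v ≤ ∑ v ∈ V, deg s t E v + 1 := by
  set T : Finset α → Prop := fun X => X ⊆ V ∧ ∑ x ∈ X, μ x = demand s t E z k X with hT
  have hunion : ∀ X Y, T X → T Y → (X ∩ Y).Nonempty → T (X ∪ Y) := by
    rintro X Y ⟨hX, hX'⟩ ⟨hY, hY'⟩ hne
    refine ⟨Finset.union_subset hX hY, ?_⟩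
    have h1 := demand_supermodular s t E z k X Y
    have h2 := hμ _ (Finset.inter_subset_left.trans hX) hne
    have h3 := hμ _ (Finset.union_subset hX hY)
      (hne.mono (Finset.inter_subset_left.trans Finset.subset_union_left))
    have h4 := Finset.sum_union_inter (s₁ := X) (s₂ := Y) (f := μ)
    omega
  have hTle : ∀ X, T X → X.Nonempty → 2 * ∑ x ∈ X, μ x ≤ ∑ x ∈ X, deg s t E x := by
    rintro X ⟨hX, hX'⟩ hne
    rw [hX', sum_deg, demand]
    split_ifs with hz
    · omega
    · have := hk X hX hz hne
      omega
  suffices H : ∀ n : ℕ, ∀ W ⊆ V, (V \ W).card = n →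
      (∀ X, T X → (X ∩ W).Nonempty → X ⊆ W) →
      2 * ∑ v ∈ W, μ v ≤ ∑ v ∈ W, deg s t E v + (if z ∈ W then 1 else 0) →
      2 * ∑ v ∈ V, μ v ≤ ∑ v ∈ V, deg s t E v + 1 from
    H _ ∅ (by simp) rfl (by simp) (by simp)
  intro n
  induction n using Nat.strong_induction_on with
  | _ n ih =>
    intro W hW hn hclosed hsum
    by_cases hWV : W = V
    · subst hWV
      split_ifs at hsum <;> omega
    obtain ⟨v, hvV, hvW⟩ := Finset.exists_of_ssubset (hW.ssubset_of_ne hWV)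
    -- `Y` is the next piece: a maximal tight set through `v`, or `v` alone
    have next : ∀ Y ⊆ V, v ∈ Y → Disjoint W Y → (∀ X, T X → (X ∩ Y).Nonempty → X ⊆ Y) →
        2 * ∑ x ∈ Y, μ x ≤ ∑ x ∈ Y, deg s t E x + (if z ∈ Y then 1 else 0) →
        2 * ∑ v ∈ V, μ v ≤ ∑ v ∈ V, deg s t E v + 1 := by
      intro Y hY hvY hdis hYc hYs
      refine ih _ ?_ (W ∪ Y) (Finset.union_subset hW hY) rfl ?_ ?_
      · rw [← hn]
        refine Finset.card_lt_card (Finset.ssubset_iff_of_subset ?_ |>.2 ⟨v, ?_, ?_⟩)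
        · exact Finset.sdiff_subset_sdiff le_rfl Finset.subset_union_left
        · simp [hvV, hvW]
        · simp [hvY]
      · intro X hX hne
        rw [Finset.inter_union_distrib_left, Finset.union_nonempty] at hne
        rcases hne with h | h
        · exact (hclosed X hX h).trans Finset.subset_union_left
        · exact (hYc X hX h).trans Finset.subset_union_right
      · rw [Finset.sum_union hdis, Finset.sum_union hdis]
        have : (if z ∈ W ∪ Y then 1 else 0) =
            (if z ∈ W then 1 else 0) + (if z ∈ Y then 1 else 0) := by
          have : z ∈ W → z ∉ Y := fun h => Finset.disjoint_left.1 hdis h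
          by_cases h1 : z ∈ W <;> by_cases h2 : z ∈ Y <;> simp_all
        omega
    by_cases hex : ∃ X, T X ∧ v ∈ X
    · obtain ⟨X, hX⟩ := hex
      have hfin : {X | T X ∧ v ∈ X}.Finite :=
        (Finset.finite_toSet V.powerset).subset fun X hX => by simpa using hX.1.1
      obtain ⟨Y, hY⟩ := hfin.exists_maximal ⟨X, hX⟩
      have hmax : ∀ X, T X → (X ∩ Y).Nonempty → X ⊆ Y := fun X hX hne =>
        Finset.subset_union_left.trans
          (hY.2 ⟨hunion X Y hX hY.1.1 hne, Finset.mem_union_right _ hY.1.2⟩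
            Finset.subset_union_right)
      refine next Y hY.1.1.1 hY.1.2 ?_ hmax
        ((hTle Y hY.1.1 ⟨v, hY.1.2⟩).trans (Nat.le_add_right _ _))
      rw [Finset.disjoint_iff_inter_eq_empty, ← Finset.not_nonempty_iff_eq_empty]
      intro hne
      rw [Finset.inter_comm] at hne
      exact hvW (hclosed Y hY.1.1 hne hY.1.2)
    · push Not at hex
      refine next {v} (by simpa) (by simp) (by simpa) ?_ ?_
      · rintro X hX ⟨x, hx⟩
        simp only [Finset.mem_inter, Finset.mem_singleton] at hx
        exact absurd (hx.2 ▸ hx.1) (hex X hX)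
      · rcases htight v hvV with h | ⟨X, h1, h2, h3⟩
        · simpa [eq_comm] using h
        · exact absurd h2 (hex X ⟨h1, h3⟩)

/-- A vector of total `|E|` that meets all demands and is at least `⌊d/2⌋`, and at least `⌈d/2⌉`
at `z`. A vector of least total among those with these lower bounds has total `|E|`. -/
lemma exists_indegree_vector {V : Finset α} {E : Finset β} {s t : β → α} {z : α} {k : ℕ}
    (hz : z ∈ V) (hE : ∀ e ∈ E, s e ∈ V ∧ t e ∈ V)
    (hk : ∀ X ⊆ V, z ∉ X → X.Nonempty → 2 * k ≤ (crossing s t E X).card) :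
    ∃ μ : α → ℕ, (∀ v ∈ V, (deg s t E v + if v = z then 1 else 0) / 2 ≤ μ v) ∧
      (∀ X ⊆ V, X.Nonempty → demand s t E z k X ≤ ∑ v ∈ X, μ v) ∧
      ∑ v ∈ V, μ v = E.card := by
  obtain ⟨μ, ⟨hg, hd⟩, hmin⟩ := exists_minimalFor_of_wellFoundedLT
    (fun μ : α → ℕ => (∀ v ∈ V, (deg s t E v + if v = z then 1 else 0) / 2 ≤ μ v) ∧
      ∀ X ⊆ V, X.Nonempty → demand s t E z k X ≤ ∑ v ∈ X, μ v)
    (fun μ => ∑ v ∈ V, μ v) (by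
      refine ⟨fun v => deg s t E v + 1 + (E.card + k), fun v _ => ?_, fun X _ ⟨x, hx⟩ => ?_⟩
      · beta_reduce
        split_ifs <;> omega
      · refine le_trans ?_ (Finset.single_le_sum
          (f := fun v => deg s t E v + 1 + (E.card + k)) (fun _ _ => Nat.zero_le _) hx)
        have : (inner s t E X).card ≤ E.card := Finset.card_filter_le _ _
        unfold demand
        split_ifs <;> omega)
  refine ⟨μ, hg, hd, ?_⟩
  have hV : demand s t E z k V = E.card := by simp [demand, hz, inner_eq_self hE]
  have hdegV : ∑ v ∈ V, deg s t E v = 2 * E.card := by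
    have : crossing s t E V = ∅ :=
      Finset.filter_eq_empty_iff.2 fun e he => by simp [hE e he]
    rw [sum_deg, inner_eq_self hE, this]; simp
  have hle := hd V le_rfl ⟨z, hz⟩
  have := two_mul_sum_le_of_tight (V := V) (μ := μ) hk hd (fun v hv => by
    by_contra! hcon
    obtain ⟨h1, h2⟩ := hcon
    have hpos : 0 < μ v := by omega
    -- otherwise lowering `μ v` by one would keep all the constraints
    have hsum : ∀ X : Finset α,
        ∑ x ∈ X, Function.update μ v (μ v - 1) x + (if v ∈ X then 1 else 0) = ∑ x ∈ X, μ x := by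
      intro X
      split_ifs with hvX
      · rw [← Finset.add_sum_erase X _ hvX, ← Finset.add_sum_erase X _ hvX,
          Function.update_self, Finset.sum_congr rfl fun x hx =>
            Function.update_of_ne (Finset.ne_of_mem_erase hx) _ _]
        omega
      · rw [Finset.sum_congr rfl fun x hx => Function.update_of_ne
          (show x ≠ v from fun h => hvX (h ▸ hx)) _ _]
        simp
    have h3 := hmin (j := Function.update μ v (μ v - 1)) ⟨fun x hx => ?_, fun X hX hne => ?_⟩
    · have := hsum V
      simp only [hv, if_true] at this
      have := h3 (by simp only; omega)
      simp only at this
      omega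
    · by_cases hxv : x = v
      · subst hxv
        rw [Function.update_self]
        have := hg x hx
        omega
      · rw [Function.update_of_ne hxv]; exact hg x hx
    · have h4 := hsum X
      have h5 := hd X hX hne
      split_ifs at h4 with hvX
      · have := h2 X hX hvX
        omega
      · omega)
  omega

/-- Heads can be chosen with in-degrees at most `μ`, by Hall's theorem for the assignment of the
edges to slots, `μ v` of them at each vertex `v`. -/
lemma exists_heads {E : Finset β} {s t : β → α} (μ : α → ℕ)
    (hμ : ∀ X : Finset α, (inner s t E X).card ≤ ∑ v ∈ X, μ v) :
    ∃ h : β → α, (∀ e ∈ E, h e = s e ∨ h e = t e) ∧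
      ∀ v, (E.filter fun e => h e = v).card ≤ μ v := by
  classical
  obtain ⟨f, hinj, hf⟩ := (Finset.all_card_le_biUnion_card_iff_exists_injective
    (fun e : E => ({s e, t e} : Finset α).sigma fun v => Finset.range (μ v))).1 (by
      intro F
      set X : Finset α := F.biUnion fun e => {s e.1, t e.1} with hX
      have h1 : (F.biUnion fun e : E => ({s e.1, t e.1} : Finset α).sigma
          fun v => Finset.range (μ v)) = X.sigma fun v => Finset.range (μ v) := by
        ext ⟨v, j⟩
        simp only [hX, Finset.mem_biUnion, Finset.mem_sigma]
        tauto
      have h2 : F.map (Function.Embedding.subtype _) ⊆ inner s t E X := by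
        intro e he
        obtain ⟨e', he', rfl⟩ := Finset.mem_map.1 he
        refine Finset.mem_filter.2 ⟨e'.2, ?_, ?_⟩ <;>
          exact Finset.mem_biUnion.2 ⟨e', he', by simp⟩
      have h3 := Finset.card_le_card h2
      rw [Finset.card_map] at h3
      rw [h1, Finset.card_sigma]
      simpa using h3.trans (hμ X))
  refine ⟨fun e => if he : e ∈ E then (f ⟨e, he⟩).1 else s e, fun e he => ?_, fun v => ?_⟩
  · have := hf ⟨e, he⟩
    simp only [Finset.mem_sigma, Finset.mem_insert, Finset.mem_singleton] at this
    simpa [he] using this.1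
  · rw [← Finset.card_range (μ v)]
    refine Finset.card_le_card_of_injOn (fun e => if he : e ∈ E then (f ⟨e, he⟩).2 else 0) ?_ ?_
    · intro e he
      obtain ⟨he, hv⟩ := Finset.mem_filter.1 he
      have := hf ⟨e, he⟩
      simp only [he, dite_true] at hv
      simp only [Finset.mem_sigma, hv] at this
      simpa [he] using this.2
    · intro e he e' he' hee
      obtain ⟨he, hv⟩ := Finset.mem_filter.1 he
      obtain ⟨he', hv'⟩ := Finset.mem_filter.1 he'
      simp only [he, he', dite_true] at hv hv' hee
      have : f ⟨e, he⟩ = f ⟨e', he'⟩ := Sigma.ext (hv.trans hv'.symm) (heq_of_eq hee)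
      exact congrArg Subtype.val (hinj this)

lemma deg_congr {F : Finset β} {s t s' t' : β → α}
    (h : ∀ e ∈ F, (s' e = s e ∧ t' e = t e) ∨ (s' e = t e ∧ t' e = s e)) (v : α) :
    deg s' t' F v = deg s t F v := by
  simp only [deg, Finset.card_filter, ← Finset.sum_add_distrib]
  refine Finset.sum_congr rfl fun e he => ?_
  rcases h e he with h | h <;> simp only [h.1, h.2]
  rw [add_comm]

/-- A rooted form of Nash-Williams' orientation theorem: if every nonempty set avoiding `z` is left
by at least `2k` edges, some orientation lets at least `k` arcs enter each such set and has
out-degrees at most `⌈d/2⌉`, and at most `⌊d/2⌋` at `z`. -/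
theorem exists_rooted_orientation {V : Finset α} {E : Finset β} {s t : β → α} {z : α} {k : ℕ}
    (hz : z ∈ V) (hE : ∀ e ∈ E, s e ∈ V ∧ t e ∈ V)
    (hk : ∀ X ⊆ V, z ∉ X → X.Nonempty → 2 * k ≤ (crossing s t E X).card) :
    ∃ s' t' : β → α,
      (∀ e ∈ E, (s' e = s e ∧ t' e = t e) ∨ (s' e = t e ∧ t' e = s e)) ∧
      (∀ v ∈ V, 2 * (E.filter fun e => s' e = v).card ≤
        deg s t E v + if v = z then 0 else 1) ∧
      ∀ X ⊆ V, z ∉ X → X.Nonempty → k ≤ (inArcs s' t' E X).card := by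
  classical
  obtain ⟨μ, hg, hd, hsum⟩ := exists_indegree_vector hz hE hk
  obtain ⟨h, hh, hle⟩ := exists_heads (E := E) (s := s) (t := t) μ (fun X => by
    have hX : inner s t E X = inner s t E (X ∩ V) := by
      refine Finset.filter_congr fun e he => ?_
      simp [hE e he]
    rw [hX]
    refine le_trans ?_ (Finset.sum_le_sum_of_subset (f := μ) (Finset.inter_subset_left (s₂ := V)))
    rcases (X ∩ V).eq_empty_or_nonempty with h0 | hne
    · simp [h0, inner]
    · exact (Nat.le_add_right _ _).trans (hd _ Finset.inter_subset_right hne))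
  set s' : β → α := fun e => if h e = t e then s e else t e with hs'
  have hor : ∀ e ∈ E, (s' e = s e ∧ h e = t e) ∨ (s' e = t e ∧ h e = s e) := by
    intro e he
    by_cases h1 : h e = t e
    · exact Or.inl ⟨by simp [hs', h1], h1⟩
    · exact Or.inr ⟨by simp [hs', h1], (hh e he).resolve_right h1⟩
  -- the in-degrees are at most `μ` and have the same sum, so they are equal to `μ`
  have hin : ∀ v ∈ V, (E.filter fun e => h e = v).card = μ v := by
    refine (Finset.sum_eq_sum_iff_of_le fun v _ => hle v).1 ?_
    rw [hsum, sum_card_filter_eq, Finset.filter_true_of_mem]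
    intro e he
    rcases hh e he with h1 | h1 <;> rw [h1]
    exacts [(hE e he).1, (hE e he).2]
  refine ⟨s', h, hor, fun v hv => ?_, fun X hX hzX hne => ?_⟩
  · have h1 := deg_congr hor v
    have h2 := hg v hv
    rw [← hin v hv, ← h1] at h2
    rw [← h1]
    unfold deg at h2 ⊢
    split_ifs at h2 ⊢ <;> omega
  · have h1 : ∑ v ∈ X, μ v = _ :=
      (Finset.sum_congr rfl fun v hv => (hin v (hX hv)).symm).trans (sum_card_head s' h E X)
    have h2 : inner s' h E X = inner s t E X := by
      refine Finset.filter_congr fun e he => ?_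
      rcases hor e he with h | h <;> rw [h.1, h.2]
      exact and_comm
    have h3 := hd X hX hne
    simp only [demand, hzX, if_false] at h3
    rw [h2] at h1
    omega

end Orientation

/-! ### Factors with degrees in prescribed intervals -/

section Factor

variable {α β : Type*} [DecidableEq α]

/-- `F` can be changed, at edges of `R` between `P` and `N` only, so that the degree at `v₀` drops
by one and that at `v` changes by `ε`, all other degrees being kept (both effects add up if
`v = v₀`). This is what switching `F` along an alternating path from `v₀` to `v` does. -/
def Shift (s t : β → α) (R F : Finset β) (P N : Finset α) (v₀ v : α) (ε : ℤ) : Prop :=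
  ∃ F' ⊆ R, (∀ x, (deg s t F' x : ℤ) =
      deg s t F x - (if v₀ = x then 1 else 0) + (if v = x then ε else 0)) ∧
    ∀ e ∈ R, ¬ (s e ∈ P ∧ t e ∈ N ∨ s e ∈ N ∧ t e ∈ P) → (e ∈ F' ↔ e ∈ F)

lemma Shift.mono {s t : β → α} {R F : Finset β} {P N P' N' : Finset α} {v₀ v : α} {ε : ℤ}
    (h : Shift s t R F P N v₀ v ε) (hP : P ⊆ P') (hN : N ⊆ N') :
    Shift s t R F P' N' v₀ v ε := by
  obtain ⟨F', h1, h2, h3⟩ := h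
  refine ⟨F', h1, h2, fun e he hn => h3 e he fun h => hn ?_⟩
  exact h.imp (fun h => ⟨hP h.1, hN h.2⟩) fun h => ⟨hN h.1, hP h.2⟩

variable [DecidableEq β]

lemma deg_insert {s t : β → α} {F : Finset β} {e : β} (he : e ∉ F) (v : α) :
    deg s t (insert e F) v =
      deg s t F v + ((if s e = v then 1 else 0) + if t e = v then 1 else 0) := by
  simp only [deg, Finset.card_filter, Finset.sum_insert he]
  omega

lemma deg_erase {s t : β → α} {F : Finset β} {e : β} (he : e ∈ F) (v : α) :
    deg s t F v =
      deg s t (F.erase e) v + ((if s e = v then 1 else 0) + if t e = v then 1 else 0) := by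
  rw [← deg_insert (Finset.notMem_erase e F), Finset.insert_erase he]

lemma deg_union {s t : β → α} {F F' : Finset β} (h : Disjoint F F') (v : α) :
    deg s t (F ∪ F') v = deg s t F v + deg s t F' v := by
  simp only [deg, Finset.card_filter, Finset.sum_union h]
  omega

lemma deg_sdiff {s t : β → α} {F R : Finset β} (h : F ⊆ R) (v : α) :
    deg s t (R \ F) v + deg s t F v = deg s t R v := by
  rw [← deg_union Finset.sdiff_disjoint, Finset.sdiff_union_of_subset h]

lemma Shift.erase {s t : β → α} {R F : Finset β} {P N : Finset α} {v₀ v w : α}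
    (h : Shift s t R F P N v₀ v 1) {e : β} (heF : e ∈ F) (heR : e ∈ R)
    (he : ¬ (s e ∈ P ∧ t e ∈ N ∨ s e ∈ N ∧ t e ∈ P))
    (hvw : s e = v ∧ t e = w ∨ s e = w ∧ t e = v) :
    ∃ F' ⊆ R, (∀ x, (deg s t F' x : ℤ) =
      deg s t F x - (if v₀ = x then 1 else 0) + (if w = x then -1 else 0)) ∧
      ∀ f ∈ R, f ≠ e → ¬ (s f ∈ P ∧ t f ∈ N ∨ s f ∈ N ∧ t f ∈ P) → (f ∈ F' ↔ f ∈ F) := by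
  obtain ⟨F', h1, h2, h3⟩ := h
  refine ⟨F'.erase e, (Finset.erase_subset _ _).trans h1, fun x => ?_, fun f hf hfe hn => ?_⟩
  · have h4 := deg_erase (s := s) (t := t) ((h3 e heR he).2 heF) x
    have h5 := h2 x
    rcases hvw with ⟨h6, h7⟩ | ⟨h6, h7⟩ <;> rw [h6, h7] at h4 <;>
      split_ifs at h4 h5 ⊢ <;> omega
  · simp [hfe, h3 f hf hn]

lemma Shift.insert {s t : β → α} {R F : Finset β} {P N : Finset α} {v₀ v w : α}
    (h : Shift s t R F P N v₀ v (-1)) {e : β} (heF : e ∉ F) (heR : e ∈ R)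
    (he : ¬ (s e ∈ P ∧ t e ∈ N ∨ s e ∈ N ∧ t e ∈ P))
    (hvw : s e = v ∧ t e = w ∨ s e = w ∧ t e = v) :
    ∃ F' ⊆ R, (∀ x, (deg s t F' x : ℤ) =
      deg s t F x - (if v₀ = x then 1 else 0) + (if w = x then 1 else 0)) ∧
      ∀ f ∈ R, f ≠ e → ¬ (s f ∈ P ∧ t f ∈ N ∨ s f ∈ N ∧ t f ∈ P) → (f ∈ F' ↔ f ∈ F) := by
  obtain ⟨F', h1, h2, h3⟩ := h
  have heF' : e ∉ F' := fun h => heF ((h3 e heR he).1 h)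
  refine ⟨Insert.insert e F', Finset.insert_subset heR h1, fun x => ?_, fun f hf hfe hn => ?_⟩
  · have h4 := deg_insert (s := s) (t := t) heF' x
    have h5 := h2 x
    rcases hvw with ⟨h6, h7⟩ | ⟨h6, h7⟩ <;> rw [h6, h7] at h4 <;>
      split_ifs at h4 h5 ⊢ <;> omega
  · simp [hfe, h3 f hf hn]

/-- If every edge of `F` at `P` leads into `N` and every edge of `R \ F` at `N` leads into `P`,
then each of these edges is counted once on the left, and its tail lies in `P ∪ N`. -/
lemma closed_card_le {s t : β → α} {R F : Finset β} {P N : Finset α} (hFR : F ⊆ R)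
    (hPN : Disjoint P N)
    (hP : ∀ e ∈ F, (s e ∈ P → t e ∈ N) ∧ (t e ∈ P → s e ∈ N))
    (hN : ∀ e ∈ R, e ∉ F → (s e ∈ N → t e ∈ P) ∧ (t e ∈ N → s e ∈ P)) :
    ∑ v ∈ P, deg s t F v + ∑ v ∈ N, deg s t (R \ F) v ≤
      ∑ v ∈ P ∪ N, (R.filter fun e => s e = v).card := by
  have hR : R = R \ F ∪ F := (Finset.sdiff_union_of_subset hFR).symm
  have hdis := Finset.disjoint_left.1 hPN
  rw [sum_card_filter_eq, Finset.card_filter]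
  conv_rhs => rw [hR, Finset.sum_union Finset.sdiff_disjoint, add_comm]
  simp only [deg, Finset.sum_add_distrib, sum_card_filter_eq]
  simp only [Finset.card_filter, ← Finset.sum_add_distrib]
  refine Nat.add_le_add (Finset.sum_le_sum fun e he => ?_) (Finset.sum_le_sum fun e he => ?_)
  · have h1 := hP e he
    have h2 := @hdis (s e)
    have h3 := @hdis (t e)
    simp only [Finset.mem_union]
    split_ifs <;> first | omega | (exfalso; tauto)
  · have h1 := hN e (Finset.mem_sdiff.1 he).1 (Finset.mem_sdiff.1 he).2
    have h2 := @hdis (s e)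
    have h3 := @hdis (t e)
    simp only [Finset.mem_union]
    split_ifs <;> first | omega | (exfalso; tauto)

/-- A degree above its upper bound can be lowered by one at the expense of at most one other
vertex, whose degree changes by one and had room for this. In the proof, `P` and `N` are the
vertices reached by alternating paths from `v₀` that end with an added edge and with a removed
edge, respectively. A vertex of `P` other than `v₀` has no room upwards and one of `N` has no room
downwards; when no path can be extended, `closed_card_le` contradicts the bounds on out- and
in-degrees. -/
lemma exists_lower_deg {V : Finset α} {R F : Finset β} {s t : β → α} {l u : α → ℤ} {v₀ : α}
    (hv₀ : v₀ ∈ V) (hR : ∀ e ∈ R, s e ∈ V ∧ t e ∈ V) (hloop : ∀ e ∈ R, s e ≠ t e)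
    (hlu : ∀ v ∈ V, v ≠ v₀ → l v < u v)
    (hout : ∀ v ∈ V, ((R.filter fun e => s e = v).card : ℤ) ≤ u v)
    (hin : ∀ v ∈ V, l v ≤ (R.filter fun e => t e = v).card)
    (hFR : F ⊆ R) (hF : u v₀ < deg s t F v₀) :
    ∃ F' ⊆ R, (deg s t F' v₀ : ℤ) = deg s t F v₀ - 1 ∧
      ∀ v ∈ V, v ≠ v₀ → deg s t F' v = deg s t F v ∨
        ((deg s t F' v : ℤ) = deg s t F v - 1 ∧ l v < deg s t F v) ∨
        ((deg s t F' v : ℤ) = deg s t F v + 1 ∧ (deg s t F v : ℤ) < u v) := by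
  by_contra hno
  -- a shift that ends at a vertex with room is excluded
  have nodown : ∀ w ∈ V, w ≠ v₀ → l w < deg s t F w → ∀ F' ⊆ R,
      ¬ ∀ x, (deg s t F' x : ℤ) =
        deg s t F x - (if v₀ = x then 1 else 0) + (if w = x then -1 else 0) := by
    intro w hw hwv hl F' hF' h
    refine hno ⟨F', hF', by simpa [hwv] using h v₀, fun v hv hne => ?_⟩
    have := h v
    rw [if_neg hne.symm] at this
    by_cases hwv' : w = v
    · subst hwv'; right; left; rw [if_pos rfl] at this; omega
    · left; rw [if_neg hwv'] at this; omega
  have noup : ∀ w ∈ V, w ≠ v₀ → (deg s t F w : ℤ) < u w → ∀ F' ⊆ R,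
      ¬ ∀ x, (deg s t F' x : ℤ) =
        deg s t F x - (if v₀ = x then 1 else 0) + (if w = x then 1 else 0) := by
    intro w hw hwv hl F' hF' h
    refine hno ⟨F', hF', by simpa [hwv] using h v₀, fun v hv hne => ?_⟩
    have := h v
    rw [if_neg hne.symm] at this
    by_cases hwv' : w = v
    · subst hwv'; right; right; rw [if_pos rfl] at this; omega
    · left; rw [if_neg hwv'] at this; omega
  suffices H : ∀ n : ℕ, ∀ P ⊆ V, ∀ N ⊆ V, Disjoint P N → v₀ ∈ P → (V \ (P ∪ N)).card = n →
      (∀ v ∈ P, v ≠ v₀ → u v ≤ deg s t F v) → (∀ v ∈ N, (deg s t F v : ℤ) ≤ l v) →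
      (∀ v ∈ P, Shift s t R F P N v₀ v 1) → (∀ v ∈ N, Shift s t R F P N v₀ v (-1)) → False by
    refine H _ {v₀} (by simpa) ∅ (by simp) (by simp) (by simp) rfl (by simp) (by simp) ?_ (by simp)
    intro v hv
    rw [Finset.mem_singleton.1 hv]
    exact ⟨F, hFR, fun x => by split_ifs <;> omega, fun e _ _ => Iff.rfl⟩
  intro n
  induction n using Nat.strong_induction_on with
  | _ n ih =>
    intro P hPV N hNV hPN hvP hn hPu hNl hPs hNs
    have hdis : ∀ {x}, x ∈ P → x ∉ N := fun hx => Finset.disjoint_left.1 hPN hx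
    have hv₀N := hdis hvP
    have hcard : ∀ w ∈ V, w ∉ P → w ∉ N → ∀ W, P ∪ N ⊆ W → w ∈ W → (V \ W).card < n := by
      intro w hw hwP hwN W hW hwW
      rw [← hn]
      refine Finset.card_lt_card (Finset.ssubset_iff_of_subset ?_ |>.2 ⟨w, ?_, ?_⟩)
      · exact Finset.sdiff_subset_sdiff le_rfl hW
      · simp [hw, hwP, hwN]
      · simp [hwW]
    -- an edge of `F` leaving `P` leads into `N`
    have stepP : ∀ e ∈ F, ∀ v w, (s e = v ∧ t e = w ∨ s e = w ∧ t e = v) → v ∈ P → w ∈ N := by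
      intro e heF v w hvw hv
      by_contra hwN
      have heR := hFR heF
      have hw : w ∈ V := by
        rcases hvw with h | h
        · exact h.2 ▸ (hR e heR).2
        · exact h.1 ▸ (hR e heR).1
      have hne : v ≠ w := by
        rintro rfl
        rcases hvw with h | h <;> exact hloop e heR (h.1.trans h.2.symm)
      have hn' : ¬ (s e ∈ P ∧ t e ∈ N ∨ s e ∈ N ∧ t e ∈ P) := by
        have := hdis hv
        rcases hvw with h | h <;> rw [h.1, h.2] <;> tauto
      by_cases hwv₀ : w = v₀
      · -- here the edge `e` alone already lowers the degree at `v₀`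
        subst hwv₀
        have h1 := hPu v hv hne
        have h2 := hlu v (hPV hv) hne
        obtain ⟨F', h3, h4, -⟩ := (show Shift s t R F {w} ∅ w w 1 from
          ⟨F, hFR, fun x => by split_ifs <;> omega, fun e _ _ => Iff.rfl⟩).erase heF heR (by simp)
          hvw.symm
        exact nodown v (hPV hv) hne (by omega) F' h3 h4
      · obtain ⟨F', h1, h2, h3⟩ := (hPs v hv).erase heF heR hn' hvw
        by_cases hl : l w < deg s t F w
        · exact nodown w hw hwv₀ hl F' h1 h2
        · by_cases hwP : w ∈ P
          · have := hPu w hwP hwv₀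
            have := hlu w hw hwv₀
            omega
          · refine ih _ (hcard w hw hwP hwN (P ∪ insert w N)
              (Finset.union_subset_union_right (Finset.subset_insert _ _)) (by simp)) P hPV
              (insert w N) (Finset.insert_subset hw hNV)
              (by simp [Finset.disjoint_insert_right, hwP, hPN]) hvP rfl hPu ?_ ?_ ?_
            · intro x hx
              rcases Finset.mem_insert.1 hx with rfl | hx
              · omega
              · exact hNl x hx
            · exact fun x hx => (hPs x hx).mono le_rfl (Finset.subset_insert _ _)
            · intro x hx
              rcases Finset.mem_insert.1 hx with rfl | hx
              · refine ⟨F', h1, h2, fun f hf hfn => ?_⟩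
                have hfe : f ≠ e := by
                  rintro rfl
                  rcases hvw with h | h <;> simp [h.1, h.2, hv] at hfn
                refine h3 f hf hfe fun h => hfn ?_
                exact h.imp (fun h => ⟨h.1, Finset.mem_insert_of_mem h.2⟩)
                  fun h => ⟨Finset.mem_insert_of_mem h.1, h.2⟩
              · exact (hNs x hx).mono le_rfl (Finset.subset_insert _ _)
    -- an edge of `R \ F` leaving `N` leads into `P`
    have stepN : ∀ e ∈ R, e ∉ F → ∀ v w, (s e = v ∧ t e = w ∨ s e = w ∧ t e = v) →
        v ∈ N → w ∈ P := by
      intro e heR heF v w hvw hv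
      by_contra hwP
      have hw : w ∈ V := by
        rcases hvw with h | h
        · exact h.2 ▸ (hR e heR).2
        · exact h.1 ▸ (hR e heR).1
      have hwv₀ : w ≠ v₀ := fun h => hwP (h ▸ hvP)
      have hvP' : v ∉ P := fun h => hdis h hv
      have hn' : ¬ (s e ∈ P ∧ t e ∈ N ∨ s e ∈ N ∧ t e ∈ P) := by
        rcases hvw with h | h <;> rw [h.1, h.2] <;> tauto
      obtain ⟨F', h1, h2, h3⟩ := (hNs v hv).insert heF heR hn' hvw
      by_cases hl : (deg s t F w : ℤ) < u w
      · exact noup w hw hwv₀ hl F' h1 h2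
      · by_cases hwN : w ∈ N
        · have := hNl w hwN
          have := hlu w hw hwv₀
          omega
        · refine ih _ (hcard w hw hwP hwN (insert w P ∪ N)
            (Finset.union_subset_union_left (Finset.subset_insert _ _)) (by simp)) (insert w P)
            (Finset.insert_subset hw hPV) N hNV
            (by simp [Finset.disjoint_insert_left, hwN, hPN]) (Finset.mem_insert_of_mem hvP)
            rfl ?_ hNl ?_ ?_
          · intro x hx hxv
            rcases Finset.mem_insert.1 hx with rfl | hx
            · omega
            · exact hPu x hx hxv
          · intro x hx
            rcases Finset.mem_insert.1 hx with rfl | hx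
            · refine ⟨F', h1, h2, fun f hf hfn => ?_⟩
              have hfe : f ≠ e := by
                rintro rfl
                rcases hvw with h | h <;> simp [h.1, h.2, hv] at hfn
              refine h3 f hf hfe fun h => hfn ?_
              exact h.imp (fun h => ⟨Finset.mem_insert_of_mem h.1, h.2⟩)
                fun h => ⟨h.1, Finset.mem_insert_of_mem h.2⟩
            · exact (hPs x hx).mono (Finset.subset_insert _ _) le_rfl
          · exact fun x hx => (hNs x hx).mono (Finset.subset_insert _ _) le_rfl
    have hcount := closed_card_le (s := s) (t := t) hFR hPN
      (fun e he => ⟨stepP e he _ _ (Or.inl ⟨rfl, rfl⟩), stepP e he _ _ (Or.inr ⟨rfl, rfl⟩)⟩)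
      (fun e he he' =>
        ⟨stepN e he he' _ _ (Or.inl ⟨rfl, rfl⟩), stepN e he he' _ _ (Or.inr ⟨rfl, rfl⟩)⟩)
    rw [Finset.sum_union hPN] at hcount
    have h1 : ∑ v ∈ P, (R.filter fun e => s e = v).card < ∑ v ∈ P, deg s t F v := by
      refine Finset.sum_lt_sum (fun v hv => ?_) ⟨v₀, hvP, ?_⟩
      · have h2 := hout v (hPV hv)
        by_cases hvv : v = v₀
        · subst hvv; omega
        · have := hPu v hv hvv; omega
      · have := hout v₀ (hPV hvP); omega
    have h2 : ∑ v ∈ N, (R.filter fun e => s e = v).card ≤ ∑ v ∈ N, deg s t (R \ F) v := by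
      refine Finset.sum_le_sum fun v hv => ?_
      have h3 := hin v (hNV hv)
      have h4 := hNl v hv
      have h5 := deg_sdiff (s := s) (t := t) hFR v
      have h6 : deg s t R v = (R.filter fun e => s e = v).card +
          (R.filter fun e => t e = v).card := rfl
      omega
    omega

/-- An orientation with out-degrees at most `u` and in-degrees at least `l`, where `l < u`,
certifies a factor with degrees in `[l, u]`. -/
theorem exists_factor {V : Finset α} {R : Finset β} {s t : β → α} {l u : α → ℤ}
    (hR : ∀ e ∈ R, s e ∈ V ∧ t e ∈ V) (hloop : ∀ e ∈ R, s e ≠ t e)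
    (hlu : ∀ v ∈ V, l v < u v)
    (hout : ∀ v ∈ V, ((R.filter fun e => s e = v).card : ℤ) ≤ u v)
    (hin : ∀ v ∈ V, l v ≤ (R.filter fun e => t e = v).card) :
    ∃ F ⊆ R, ∀ v ∈ V, l v ≤ deg s t F v ∧ (deg s t F v : ℤ) ≤ u v := by
  obtain ⟨F, ⟨hFR, hFl⟩, hmin⟩ := exists_minimalFor_of_wellFoundedLT
    (fun F : Finset β => F ⊆ R ∧ ∀ v ∈ V, l v ≤ deg s t F v)
    (fun F => ∑ v ∈ V, ((deg s t F v : ℤ) - u v).toNat)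
    ⟨R, le_rfl, fun v hv => (hin v hv).trans (by unfold deg; omega)⟩
  refine ⟨F, hFR, fun v₀ hv₀ => ⟨hFl v₀ hv₀, ?_⟩⟩
  by_contra! hcon
  obtain ⟨F', hF'R, h1, h2⟩ := exists_lower_deg hv₀ hR hloop (fun v hv _ => hlu v hv) hout hin
    hFR hcon
  have hlt : ∑ v ∈ V, ((deg s t F' v : ℤ) - u v).toNat <
      ∑ v ∈ V, ((deg s t F v : ℤ) - u v).toNat := by
    refine Finset.sum_lt_sum (fun v hv => ?_) ⟨v₀, hv₀, by omega⟩
    by_cases hvv : v = v₀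
    · subst hvv; omega
    · have := h2 v hv hvv; omega
  refine absurd (hmin (j := F') ⟨hF'R, fun v hv => ?_⟩ hlt.le) (not_le.2 hlt)
  by_cases hvv : v = v₀
  · subst hvv
    have := hlu v hv
    omega
  · have := h2 v hv hvv
    have := hFl v hv
    omega

/-- The degree at one vertex `z` can be prescribed exactly. -/
theorem exists_factor_eq {V : Finset α} {R : Finset β} {s t : β → α} {l u : α → ℤ} {z : α}
    {r : ℤ} (hz : z ∈ V)
    (hR : ∀ e ∈ R, s e ∈ V ∧ t e ∈ V) (hloop : ∀ e ∈ R, s e ≠ t e)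
    (hlu : ∀ v ∈ V, v ≠ z → l v < u v)
    (hout : ∀ v ∈ V, v ≠ z → ((R.filter fun e => s e = v).card : ℤ) ≤ u v)
    (hin : ∀ v ∈ V, v ≠ z → l v ≤ (R.filter fun e => t e = v).card)
    (hzout : ((R.filter fun e => s e = z).card : ℤ) ≤ r)
    (hzin : r ≤ (R.filter fun e => t e = z).card) :
    ∃ F ⊆ R, (deg s t F z : ℤ) = r ∧
      ∀ v ∈ V, v ≠ z → l v ≤ deg s t F v ∧ (deg s t F v : ℤ) ≤ u v := by
  -- first allow the two values `r` and `r + 1` at `z`, to have an interval of positive length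
  obtain ⟨F, hFR, hF⟩ := exists_factor (l := Function.update l z r)
    (u := Function.update u z (r + 1)) hR hloop
    (fun v hv => by by_cases h : v = z <;> simp [h, hlu, hv])
    (fun v hv => by
      by_cases h : v = z
      · subst h; simp only [Function.update_self]; omega
      · simp [h, hout, hv])
    (fun v hv => by
      by_cases h : v = z
      · subst h; simpa using hzin
      · simp [h, hin, hv])
  have hFv : ∀ v ∈ V, v ≠ z → l v ≤ deg s t F v ∧ (deg s t F v : ℤ) ≤ u v := fun v hv hvz => by
    simpa [hvz] using hF v hv
  have hFz := hF z hz
  simp only [Function.update_self] at hFz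
  by_cases hr : (deg s t F z : ℤ) = r
  · exact ⟨F, hFR, hr, hFv⟩
  -- the degree at `z` is `r + 1`: one more step lowers it to `r`
  · obtain ⟨F', hF'R, h1, h2⟩ := exists_lower_deg (l := Function.update l z r)
      (u := Function.update u z r) (v₀ := z) hz hR hloop
      (fun v hv hvz => by simp [hvz, hlu, hv])
      (fun v hv => by
        by_cases h : v = z
        · subst h; simpa using hzout
        · simp [h, hout, hv])
      (fun v hv => by
        by_cases h : v = z
        · subst h; simpa using hzin
        · simp [h, hin, hv])
      hFR (by simp only [Function.update_self]; omega)
    refine ⟨F', hF'R, by omega, fun v hv hvz => ?_⟩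
    have h3 := h2 v hv hvz
    have h4 := hFv v hv hvz
    simp only [Function.update_of_ne hvz] at h3
    omega

end Factor

/-! ### Splitting the edge set -/

section Split

variable {α β : Type*} [DecidableEq α] [DecidableEq β]

lemma Arb.card_filter_tail_root {s t : β → α} {z : α} {U : Finset α} {A : Finset β}
    (h : Arb s t z U A) {w : α} (hw : w ∈ U) (hwz : w ≠ z) :
    1 ≤ (A.filter fun e => s e = z).card := by
  rcases (h.reflTransGen w hw).cases_head with h | ⟨_, ⟨e, he, hs, _⟩, _⟩
  · exact absurd h.symm hwz
  · exact Finset.card_pos.2 ⟨e, Finset.mem_filter.2 ⟨he, hs⟩⟩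

/-- `A` is the edge set of a tree with vertex set `V`, up to the orientation of its edges: it can be
oriented as an arborescence. -/
def IsSpanningTree (s t : β → α) (V : Finset α) (A : Finset β) : Prop :=
  ∃ (z : α) (s' t' : β → α),
    (∀ e ∈ A, (s' e = s e ∧ t' e = t e) ∨ (s' e = t e ∧ t' e = s e)) ∧ Arb s' t' z V A

/-- `F` contains `n` disjoint edge sets of spanning trees. -/
def HasTrees (s t : β → α) (V : Finset α) (F : Finset β) (n : ℕ) : Prop :=
  ∃ A : Fin n → Finset β, (∀ i, A i ⊆ F ∧ IsSpanningTree s t V (A i)) ∧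
    ∀ i j, i ≠ j → Disjoint (A i) (A j)

lemma HasTrees.mono {s t : β → α} {V : Finset α} {F F' : Finset β} {n : ℕ}
    (h : HasTrees s t V F n) (hF : F ⊆ F') : HasTrees s t V F' n :=
  h.imp fun _ hA => ⟨fun i => ⟨(hA.1 i).1.trans hF, (hA.1 i).2⟩, hA.2⟩

/-- `H ⊆ E` contains `m` disjoint spanning trees, its complement contains `m₀`, and the degrees of
`H` lie between `⌊d/2⌋ - m₀` and `⌈d/2⌉ + m`. -/
structure IsSplit (s t : β → α) (V : Finset α) (E H : Finset β) (m m₀ : ℕ) : Prop where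
  subset : H ⊆ E
  trees : HasTrees s t V H m
  cotrees : HasTrees s t V (E \ H) m₀
  le_deg : ∀ v ∈ V, deg s t E v / 2 ≤ deg s t H v + m₀
  deg_le : ∀ v ∈ V, deg s t H v ≤ (deg s t E v + 1) / 2 + m

lemma card_filter_biUnion {n : ℕ} {A : Fin n → Finset β}
    (hA : ∀ i j, i ≠ j → Disjoint (A i) (A j)) (f : β → α) (v : α) :
    ((Finset.univ.biUnion A).filter fun e => f e = v).card =
      ∑ i, ((A i).filter fun e => f e = v).card := by
  rw [Finset.filter_biUnion, Finset.card_biUnion]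
  exact fun i _ j _ hij => Finset.disjoint_filter_filter (hA i j hij)

/-- The loopless case with a prescribed degree at `z`. The vertex `w` ensures that every spanning
arborescence uses an arc leaving `z`. -/
theorem exists_isSplit_of_loopless {V : Finset α} {E : Finset β} {s t : β → α} {z w : α}
    {m m₀ : ℕ} (hm : 0 < m + m₀) (hz : z ∈ V) (hw : w ∈ V) (hwz : w ≠ z)
    (hE : ∀ e ∈ E, s e ∈ V ∧ t e ∈ V) (hloop : ∀ e ∈ E, s e ≠ t e)
    (hk : ∀ X ⊆ V, z ∉ X → X.Nonempty → 2 * (m + m₀) ≤ (crossing s t E X).card)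
    {r : ℕ} (hr : deg s t E z / 2 ≤ r + m₀) (hr' : r ≤ (deg s t E z + 1) / 2 + m) :
    ∃ H, IsSplit s t V E H m m₀ ∧ deg s t H z = r := by
  obtain ⟨s', t', hor, hbal, hcut⟩ := exists_rooted_orientation hz hE hk
  have hE' : ∀ e ∈ E, s' e ∈ V ∧ t' e ∈ V := fun e he => by
    have := hE e he
    rcases hor e he with h | h <;> simp [h, this]
  have hloop' : ∀ e ∈ E, s' e ≠ t' e := fun e he => by
    have := hloop e he
    rcases hor e he with h | h <;> simp [h, this, this.symm]
  obtain ⟨A, hA, hdis⟩ := exists_disjoint_spanning_arbs hz (m + m₀) (fun e he => (hE' e he).1) hcut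
  have hdis₁ : ∀ i j : Fin m, i ≠ j → Disjoint (A (Fin.castAdd m₀ i)) (A (Fin.castAdd m₀ j)) :=
    fun i j h => hdis _ _ fun h' => h (Fin.castAdd_injective _ _ h')
  have hdis₂ : ∀ i j : Fin m₀, i ≠ j → Disjoint (A (Fin.natAdd m i)) (A (Fin.natAdd m j)) :=
    fun i j h => hdis _ _ fun h' => h (Fin.natAdd_injective _ _ h')
  set T : Finset β := Finset.univ.biUnion fun i : Fin m => A (Fin.castAdd m₀ i) with hT
  set M : Finset β := Finset.univ.biUnion fun i : Fin m₀ => A (Fin.natAdd m i) with hM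
  have hTM : Disjoint T M := by
    simp only [hT, hM, Finset.disjoint_biUnion_left, Finset.disjoint_biUnion_right]
    intro i _ j _
    refine hdis _ _ fun h => ?_
    have := congrArg Fin.val h
    simp at this
    omega
  have hTE : T ⊆ E := Finset.biUnion_subset.2 fun i _ => (hA _).1
  have hME : M ⊆ E := Finset.biUnion_subset.2 fun i _ => (hA _).1
  have hTin : ∀ v ∈ V, (T.filter fun e => t' e = v).card = if v = z then 0 else m := by
    intro v hv
    rw [hT, card_filter_biUnion hdis₁,
      Finset.sum_congr rfl fun i _ => (hA _).2.card_filter_head v hv]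
    split_ifs <;> simp
  have hMin : ∀ v ∈ V, (M.filter fun e => t' e = v).card = if v = z then 0 else m₀ := by
    intro v hv
    rw [hM, card_filter_biUnion hdis₂,
      Finset.sum_congr rfl fun i _ => (hA _).2.card_filter_head v hv]
    split_ifs <;> simp
  have hTz : m ≤ (T.filter fun e => s' e = z).card := by
    rw [hT, card_filter_biUnion hdis₁]
    simpa using Finset.card_nsmul_le_sum Finset.univ _ 1
      fun i _ => (hA (Fin.castAdd m₀ i)).2.card_filter_tail_root hw hwz
  have hMz : m₀ ≤ (M.filter fun e => s' e = z).card := by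
    rw [hM, card_filter_biUnion hdis₂]
    simpa using Finset.card_nsmul_le_sum Finset.univ _ 1
      fun i _ => (hA (Fin.natAdd m i)).2.card_filter_tail_root hw hwz
  set R : Finset β := E \ (T ∪ M) with hRdef
  have hRE : R ⊆ E := Finset.sdiff_subset
  have hcard : ∀ (f : β → α) (v : α), (E.filter fun e => f e = v).card =
      (R.filter fun e => f e = v).card + (T.filter fun e => f e = v).card +
        (M.filter fun e => f e = v).card := by
    intro f v
    have : E = R ∪ (T ∪ M) := (Finset.sdiff_union_of_subset (Finset.union_subset hTE hME)).symm
    conv_lhs => rw [this]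
    simp only [Finset.card_filter]
    rw [Finset.sum_union Finset.sdiff_disjoint, Finset.sum_union hTM, add_assoc]
  have hdegE : ∀ v, deg s t E v =
      (E.filter fun e => s' e = v).card + (E.filter fun e => t' e = v).card :=
    fun v => (deg_congr hor v).symm
  have hdegT : ∀ v, deg s' t' T v =
      (T.filter fun e => s' e = v).card + (T.filter fun e => t' e = v).card := fun v => rfl
  -- `T ∪ F` has to meet the degree bounds, so the bounds for `F` are lowered by the degrees of `T`
  obtain ⟨F, hFR, hFz, hF⟩ := exists_factor_eq (V := V) (R := R) (s := s') (t := t')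
    (l := fun v => (deg s t E v / 2 : ℕ) - (m₀ : ℤ) - deg s' t' T v)
    (u := fun v => ((deg s t E v + 1) / 2 : ℕ) + (m : ℤ) - deg s' t' T v)
    (r := (r : ℤ) - deg s' t' T z) hz (fun e he => hE' e (hRE he)) (fun e he => hloop' e (hRE he))
    (fun v _ _ => by omega)
    (fun v hv hvz => by
      have h1 := hbal v hv
      have h2 := hTin v hv
      have h3 := hcard s' v
      rw [if_neg hvz] at h1 h2
      have h4 := hdegT v
      omega)
    (fun v hv hvz => by
      have h1 := hbal v hv
      have h2 := hTin v hv
      have h3 := hMin v hv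
      rw [if_neg hvz] at h1 h2 h3
      have h4 := hcard t' v
      have h5 := hdegT v
      have h6 := hdegE v
      omega)
    (by
      have h1 := hbal z hz
      have h2 := hTin z hz
      rw [if_pos rfl] at h1 h2
      have h3 := hcard s' z
      have h4 := hdegT z
      omega)
    (by
      have h1 := hbal z hz
      have h2 := hTin z hz
      have h3 := hMin z hz
      rw [if_pos rfl] at h1 h2 h3
      have h4 := hcard t' z
      have h5 := hdegT z
      have h6 := hdegE z
      omega)
  have hFT : Disjoint T F := Finset.disjoint_of_subset_right hFR
    (Finset.disjoint_sdiff.mono_left Finset.subset_union_left)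
  have hFM : Disjoint M F := Finset.disjoint_of_subset_right hFR
    (Finset.disjoint_sdiff.mono_left Finset.subset_union_right)
  have hHE : T ∪ F ⊆ E := Finset.union_subset hTE (hFR.trans hRE)
  have hdegH : ∀ v, deg s t (T ∪ F) v = deg s' t' T v + deg s' t' F v := fun v => by
    rw [← deg_union hFT, deg_congr fun e he => hor e (hHE he)]
  have htree : ∀ i, IsSpanningTree s t V (A i) := fun i =>
    ⟨z, s', t', fun e he => hor e ((hA i).1 he), (hA i).2⟩
  refine ⟨T ∪ F, ⟨hHE, ⟨_, fun i => ⟨?_, htree _⟩, hdis₁⟩,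
    ⟨_, fun i => ⟨?_, htree _⟩, hdis₂⟩, ?_, ?_⟩, ?_⟩
  · exact (Finset.subset_biUnion_of_mem (fun i : Fin m => A (Fin.castAdd m₀ i))
      (Finset.mem_univ i)).trans Finset.subset_union_left
  · refine (Finset.subset_biUnion_of_mem (fun i : Fin m₀ => A (Fin.natAdd m i))
      (Finset.mem_univ i)).trans (Finset.subset_sdiff.2 ⟨hME, ?_⟩)
    exact Finset.disjoint_union_right.2 ⟨hTM.symm, hFM⟩
  · intro v hv
    have h1 := hdegH v
    by_cases hvz : v = z
    · subst hvz; omega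
    · have := hF v hv hvz
      omega
  · intro v hv
    have h1 := hdegH v
    by_cases hvz : v = z
    · subst hvz; omega
    · have := hF v hv hvz
      omega
  · have := hdegH z
    omega

namespace IsSplit

variable {s t : β → α} {V : Finset α} {E H : Finset β} {m m₀ : ℕ} {e : β}

/-- A loop may be put in `H` if the degree at its vertex is not the largest one allowed. -/
lemma insert_both (h : IsSplit s t V E H m m₀) (he : e ∉ E) (hl : s e = t e)
    (hlt : deg s t H (s e) < (deg s t E (s e) + 1) / 2 + m) :
    IsSplit s t V (insert e E) (insert e H) m m₀ where
  subset := Finset.insert_subset_insert _ h.subset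
  trees := h.trees.mono (Finset.subset_insert _ _)
  cotrees := h.cotrees.mono fun f hf => by
    have hfe : f ≠ e := fun hfe => he (hfe ▸ (Finset.mem_sdiff.1 hf).1)
    simp_all
  le_deg v hv := by
    have := h.le_deg v hv
    rw [deg_insert he, deg_insert fun h' => he (h.subset h'), ← hl]
    split_ifs <;> omega
  deg_le v hv := by
    have := h.deg_le v hv
    rw [deg_insert he, deg_insert fun h' => he (h.subset h'), ← hl]
    split_ifs with hv'
    · subst hv'; omega
    · omega

/-- A loop may be put in the complement if the degree at its vertex is not the least one allowed. -/
lemma insert_left (h : IsSplit s t V E H m m₀) (he : e ∉ E) (hl : s e = t e)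
    (hlt : deg s t E (s e) / 2 < deg s t H (s e) + m₀) :
    IsSplit s t V (insert e E) H m m₀ where
  subset := h.subset.trans (Finset.subset_insert _ _)
  trees := h.trees
  cotrees := h.cotrees.mono (Finset.sdiff_subset_sdiff (Finset.subset_insert _ _) le_rfl)
  le_deg v hv := by
    have := h.le_deg v hv
    rw [deg_insert he, ← hl]
    split_ifs with hv'
    · subst hv'; omega
    · omega
  deg_le v hv := by
    have := h.deg_le v hv
    rw [deg_insert he]
    omega

end IsSplit

lemma exists_isSplit_union_loops {s t : β → α} {V : Finset α} {E : Finset β} {m m₀ : ℕ}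
    (hm : 0 < m + m₀) (h : ∃ H, IsSplit s t V E H m m₀) (L : Finset β)
    (hL : ∀ e ∈ L, s e = t e) (hLE : Disjoint L E) :
    ∃ H, IsSplit s t V (L ∪ E) H m m₀ := by
  induction L using Finset.induction_on with
  | empty => simpa using h
  | insert e L heL ih =>
    rw [Finset.disjoint_insert_left] at hLE
    obtain ⟨H, hH⟩ := ih (fun f hf => hL f (Finset.mem_insert_of_mem hf)) hLE.2
    have he : e ∉ L ∪ E := by simp [heL, hLE.1]
    have hl := hL e (Finset.mem_insert_self _ _)
    rw [Finset.insert_union]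
    by_cases hlt : deg s t H (s e) < (deg s t (L ∪ E) (s e) + 1) / 2 + m
    · exact ⟨_, hH.insert_both he hl hlt⟩
    · exact ⟨_, hH.insert_left he hl (by omega)⟩

/-- The hypothesis on the degree of `z` keeps `r - 2` from being truncated when a loop at `z` has to
go into `H`. -/
lemma exists_isSplit_union_loops_eq {s t : β → α} {V : Finset α} {E : Finset β} {m m₀ : ℕ}
    {z : α} (hm : 0 < m + m₀) (hd : 2 ≤ deg s t E z)
    (h : ∀ r, deg s t E z / 2 ≤ r + m₀ → r ≤ (deg s t E z + 1) / 2 + m →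
      ∃ H, IsSplit s t V E H m m₀ ∧ deg s t H z = r) (L : Finset β)
    (hL : ∀ e ∈ L, s e = t e) (hLE : Disjoint L E) :
    ∀ r, deg s t (L ∪ E) z / 2 ≤ r + m₀ → r ≤ (deg s t (L ∪ E) z + 1) / 2 + m →
      ∃ H, IsSplit s t V (L ∪ E) H m m₀ ∧ deg s t H z = r := by
  induction L using Finset.induction_on with
  | empty => simpa using h
  | insert e L heL ih =>
    intro r hr hr'
    rw [Finset.disjoint_insert_left] at hLE
    have ih' := ih (fun f hf => hL f (Finset.mem_insert_of_mem hf)) hLE.2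
    have he : e ∉ L ∪ E := by simp [heL, hLE.1]
    have hl := hL e (Finset.mem_insert_self _ _)
    rw [Finset.insert_union] at hr hr' ⊢
    rw [deg_insert he, ← hl] at hr hr'
    have hd' : 2 ≤ deg s t (L ∪ E) z := by
      rw [deg_union hLE.2]
      omega
    by_cases hez : s e = z
    · subst hez
      rw [if_pos rfl] at hr hr'
      by_cases hrr : r ≤ (deg s t (L ∪ E) (s e) + 1) / 2 + m
      · obtain ⟨H, hH, hHr⟩ := ih' r (by omega) hrr
        exact ⟨H, hH.insert_left he hl (by omega), hHr⟩
      · obtain ⟨H, hH, hHr⟩ := ih' (r - 2) (by omega) (by omega)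
        refine ⟨_, hH.insert_both he hl (by omega), ?_⟩
        rw [deg_insert fun h' => he (hH.subset h'), ← hl, if_pos rfl]
        omega
    · rw [if_neg hez] at hr hr'
      obtain ⟨H, hH, hHr⟩ := ih' r (by omega) (by omega)
      by_cases hlt : deg s t H (s e) < (deg s t (L ∪ E) (s e) + 1) / 2 + m
      · refine ⟨_, hH.insert_both he hl hlt, ?_⟩
        rw [deg_insert fun h' => he (hH.subset h'), ← hl, if_neg hez, hHr, add_zero,
          add_zero]
      · exact ⟨_, hH.insert_left he hl (by omega), hHr⟩

end Split

/-! ### Multigraphs in terms of their end functions -/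

section Transfer

variable {α β : Type*}

lemma restrict_isSpanningSubgraph (G : Graph α β) (F : Set β) : G.restrict F ≤s G :=
  ⟨Graph.restrict_le, rfl⟩

variable [DecidableEq α] [DecidableEq β]

lemma degree_restrict {G : Graph α β} {s t : β → α} {F : Finset β}
    (hF : ∀ e ∈ F, G.IsLink e (s e) (t e)) (v : α) :
    (G.restrict (F : Set β)).degree v = deg s t F v := by
  have h1 : (G.restrict (F : Set β)).incidenceSet v =
      ((F.filter fun e => s e = v) ∪ (F.filter fun e => t e = v) : Finset β) := by
    ext e
    simp only [Graph.mem_incidenceSet, Graph.restrict_inc, Finset.mem_coe, Finset.mem_union,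
      Finset.mem_filter]
    constructor
    · rintro ⟨h, he⟩
      rcases h.eq_or_eq_of_isLink (hF e he) with h | h <;> simp [he, h]
    · rintro (⟨he, rfl⟩ | ⟨he, rfl⟩)
      exacts [⟨(hF e he).inc_left, he⟩, ⟨(hF e he).inc_right, he⟩]
  have h2 : (G.restrict (F : Set β)).loopSet v =
      ((F.filter fun e => s e = v) ∩ (F.filter fun e => t e = v) : Finset β) := by
    ext e
    simp only [Graph.mem_loopSet, Graph.restrict_isLoopAt, Finset.mem_coe, Finset.mem_inter,
      Finset.mem_filter]
    constructor
    · rintro ⟨h, he⟩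
      have h3 := h.eq_of_inc (hF e he).inc_left
      have h4 := h.eq_of_inc (hF e he).inc_right
      simp [he, ← h3, ← h4]
    · rintro ⟨⟨he, h3⟩, -, h4⟩
      have := hF e he
      rw [h3, h4] at this
      exact ⟨this, he⟩
  rw [Graph.degree, h1, h2, Set.ncard_coe_finset, Set.ncard_coe_finset,
    Finset.card_union_add_card_inter, deg]

lemma IsSpanningTree.isTree {G : Graph α β} {V : Finset α} {s t : β → α} {A : Finset β}
    (hV : V(G) = V) (hA : ∀ e ∈ A, G.IsLink e (s e) (t e)) (h : IsSpanningTree s t V A) :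
    (G.restrict (A : Set β)).IsTree := by
  obtain ⟨z, s', t', hor, harb⟩ := h
  have hl : ∀ e ∈ A, G.IsLink e (s' e) (t' e) := fun e he => by
    rcases hor e he with h | h <;> rw [h.1, h.2]
    exacts [hA e he, (hA e he).symm]
  refine ⟨⟨⟨z, ?_⟩, fun x hx y hy => ?_⟩, fun n v c _ hc hlink => ?_⟩
  · simpa [hV] using harb.root_mem
  · have hadj : ∀ a b, (∃ e ∈ A, s' e = a ∧ t' e = b) → (G.restrict (A : Set β)).Adj a b := by
      rintro a b ⟨e, he, rfl, rfl⟩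
      exact ⟨e, by simpa [he] using hl e he⟩
    have hreach : ∀ v ∈ V, Relation.ReflTransGen (G.restrict (A : Set β)).Adj z v := fun v hv =>
      Relation.ReflTransGen.mono hadj _ _ (harb.reflTransGen v hv)
    have : Std.Symm (G.restrict (A : Set β)).Adj := ⟨fun _ _ h => h.symm⟩
    have hsymm : ∀ v ∈ V, Relation.ReflTransGen (G.restrict (A : Set β)).Adj v z := fun v hv =>
      symm (hreach v hv)
    simp only [Graph.vertexSet_restrict, hV, Finset.mem_coe] at hx hy
    exact (hsymm x hx).trans (hreach y hy)
  · simp only [Graph.restrict_isLink, Finset.mem_coe] at hlink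
    refine harb.acyclic n v c hc (fun i => (hlink i).1) fun i => ?_
    have := (hl _ (hlink i).1).eq_and_eq_or_eq_and_eq (hlink i).2
    tauto

lemma HasTrees.isTreeConnected {G K : Graph α β} {V : Finset α} {s t : β → α} {F : Finset β}
    {n : ℕ} (hV : V(G) = V) (hF : ∀ e ∈ F, G.IsLink e (s e) (t e)) (hK : K ≤s G)
    (hFK : (F : Set β) ⊆ E(K)) (h : HasTrees s t V F n) : K.IsTreeConnected n := by
  obtain ⟨A, hA, hdis⟩ := h
  refine ⟨fun i => G.restrict (A i), fun i => ⟨?_, ?_⟩, fun i j hij => ?_⟩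
  · refine Graph.IsSpanningSubgraph.anti_right ?_ hK.le (restrict_isSpanningSubgraph G _)
    refine (Graph.Compatible.of_le_le Graph.restrict_le hK.le).le_iff.2 ⟨?_, ?_⟩
    · rw [hK.vertexSet_eq]; rfl
    · exact fun e he => hFK ((hA i).1 (by simp at he; exact he.2))
  · exact (hA i).2.isTree hV fun e he => hF e ((hA i).1 he)
  · rw [Graph.edgeSet_restrict, Graph.edgeSet_restrict]
    exact (Finset.disjoint_coe.2 (hdis i j hij)).mono Set.inter_subset_right Set.inter_subset_right

lemma floor_half (d : ℕ) : ⌊(d : ℚ) / 2⌋ = ((d / 2 : ℕ) : ℤ) := by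
  rw [Int.floor_eq_iff]
  have h : 2 * (d / 2) ≤ d ∧ d < 2 * (d / 2) + 2 := by omega
  have h1 : (2 * (d / 2 : ℕ) : ℚ) ≤ d := by exact_mod_cast h.1
  have h2 : (d : ℚ) < 2 * (d / 2 : ℕ) + 2 := by exact_mod_cast h.2
  rw [Int.cast_natCast]
  constructor <;> linarith

lemma ceil_half (d : ℕ) : ⌈(d : ℚ) / 2⌉ = (((d + 1) / 2 : ℕ) : ℤ) := by
  rw [Int.ceil_eq_iff]
  have h : 2 * ((d + 1) / 2) < d + 2 ∧ d ≤ 2 * ((d + 1) / 2) := by omega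
  have h1 : (2 * ((d + 1) / 2 : ℕ) : ℚ) < d + 2 := by exact_mod_cast h.1
  have h2 : (d : ℚ) ≤ 2 * ((d + 1) / 2 : ℕ) := by exact_mod_cast h.2
  rw [Int.cast_natCast]
  constructor <;> linarith

lemma IsSplit.isBoundedTreeConnectedFactor {G : Graph α β} {V : Finset α} {E H : Finset β}
    {s t : β → α} {m m₀ : ℕ} (hV : V(G) = V) (hE : E(G) = E)
    (hst : ∀ e ∈ E, G.IsLink e (s e) (t e)) (h : IsSplit s t V E H m m₀) :
    G.IsBoundedTreeConnectedFactor (G.restrict (H : Set β)) m m₀ := by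
  have hEH : E(G.restrict (H : Set β)) = H := by
    rw [Graph.edgeSet_restrict, hE]
    exact Set.inter_eq_right.2 (Finset.coe_subset.2 h.subset)
  have hG : ∀ v, G.degree v = deg s t E v := fun v => by
    rw [← degree_restrict hst v, ← hE, Graph.restrict_self]
  have hH : ∀ v, (G.restrict (H : Set β)).degree v = deg s t H v :=
    degree_restrict fun e he => hst e (h.subset he)
  refine ⟨restrict_isSpanningSubgraph G _, ?_, ?_, fun v hv => ?_⟩
  · exact h.trees.isTreeConnected hV (fun e he => hst e (h.subset he))
      (restrict_isSpanningSubgraph G _) hEH.ge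
  · refine h.cotrees.isTreeConnected hV (fun e he => hst e (Finset.mem_sdiff.1 he).1)
      ⟨Graph.deleteEdges_le, rfl⟩ ?_
    rw [Graph.edgeSet_deleteEdges, hEH, hE, Finset.coe_sdiff]
  · have hv' : v ∈ V := by simpa [hV] using hv
    have h1 := h.le_deg v hv'
    have h2 := h.deg_le v hv'
    rw [hG, hH, floor_half, ceil_half]
    omega

lemma isSplit_empty {s t : β → α} (z : α) (m m₀ : ℕ) :
    IsSplit s t {z} ∅ ∅ m m₀ := by
  have htree : ∀ n, HasTrees s t {z} (∅ : Finset β) n := fun n =>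
    ⟨fun _ => ∅, fun _ => ⟨le_rfl, z, s, t, by simp, Arb.single⟩, by simp⟩
  exact ⟨le_rfl, htree m, htree m₀, by simp [deg], by simp [deg]⟩

end Transfer

end MultiArc

open MultiArc

theorem mainTheorem8 {α β : Type*} (G : Graph α β) (hV : V(G).Finite) (hE : E(G).Finite)
    (hne : V(G).Nonempty) (m m₀ : ℕ) (hm : 0 < m + m₀)
    (hG : G.IsEdgeConnected (2 * m + 2 * m₀)) :
    (∃ H : Graph α β, G.IsBoundedTreeConnectedFactor H m m₀) ∧
    (V(G).Nontrivial → ∀ z ∈ V(G), ∀ t : ℤ,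
      ⌊(G.degree z : ℚ) / 2⌋ - (m₀ : ℤ) ≤ t → t ≤ ⌈(G.degree z : ℚ) / 2⌉ + (m : ℤ) →
      ∃ H : Graph α β, G.IsBoundedTreeConnectedFactor H m m₀ ∧ (H.degree z : ℤ) = t) := by
  classical
  obtain ⟨V, hVV⟩ := hV.exists_finset_coe
  obtain ⟨E, hEE⟩ := hE.exists_finset_coe
  obtain ⟨v₀, hv₀⟩ := hne
  have hends : ∀ e, ∃ p : α × α, e ∈ E → G.IsLink e p.1 p.2 := fun e => by
    by_cases he : e ∈ E
    · obtain ⟨x, y, h⟩ := Graph.exists_isLink_of_mem_edgeSet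
        (show e ∈ E(G) from hEE ▸ Finset.mem_coe.2 he)
      exact ⟨(x, y), fun _ => h⟩
    · exact ⟨(v₀, v₀), fun h => absurd h he⟩
  choose p hp using hends
  set s : β → α := fun e => (p e).1 with hs
  set t : β → α := fun e => (p e).2 with ht
  have hmem : ∀ {x}, x ∈ V ↔ x ∈ V(G) := fun {x} => by rw [← hVV]; rfl
  set L : Finset β := E.filter fun e => s e = t e with hL
  set E₀ : Finset β := E.filter fun e => s e ≠ t e with hE₀
  have hLE : L ∪ E₀ = E := Finset.filter_union_filter_not_eq _ _
  have hdis : Disjoint L E₀ := Finset.disjoint_filter_filter_not _ _ _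
  have hE₀V : ∀ e ∈ E₀, s e ∈ V ∧ t e ∈ V := fun e he =>
    have h := hp e (Finset.filter_subset _ _ he)
    ⟨hmem.2 h.left_mem, hmem.2 h.right_mem⟩
  have hGE : ∀ v, G.degree v = deg s t E v := fun v => by
    rw [← degree_restrict hp v, hEE, Graph.restrict_self]
  have hcut : ∀ z ∈ V, ∀ X ⊆ V, z ∉ X → X.Nonempty →
      2 * (m + m₀) ≤ (crossing s t E₀ X).card := by
    intro z hz X hX hzX hne
    have h1 := hG X (by simpa using hne) ⟨fun x hx => hmem.1 (hX hx),
      fun h => hzX (h (hmem.1 hz))⟩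
    have h2 : G.edgeCut X = (crossing s t E₀ X : Set β) := by
      ext e
      simp only [Graph.edgeCut, crossing, hE₀, Finset.coe_filter, Finset.mem_filter,
        Set.mem_ofPred_eq, Finset.mem_coe]
      constructor
      · rintro ⟨x, hx, y, hy, h⟩
        have he : e ∈ E := by
          rw [← Finset.mem_coe, hEE]; exact h.edge_mem
        rcases (hp e he).eq_and_eq_or_eq_and_eq h with ⟨h1, h2⟩ | ⟨h1, h2⟩ <;>
          simp only [hs, ht, h1, h2, he, hx, hy] <;>
          refine ⟨⟨trivial, ?_⟩, by simp⟩
        · rintro rfl; exact hy hx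
        · rintro rfl; exact hy hx
      · rintro ⟨⟨he, -⟩, h⟩
        by_cases h3 : s e ∈ X
        · exact ⟨s e, h3, t e, by tauto, hp e he⟩
        · exact ⟨t e, by tauto, s e, h3, (hp e he).symm⟩
    rw [h2, Set.ncard_coe_finset] at h1
    omega
  have hLl : ∀ e ∈ L, s e = t e := fun e he => (Finset.mem_filter.1 he).2
  have hvalue : V(G).Nontrivial → ∀ z ∈ V(G), 2 * (m + m₀) ≤ deg s t E z ∧
      ∀ r : ℕ, deg s t E z / 2 ≤ r + m₀ → r ≤ (deg s t E z + 1) / 2 + m →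
        ∃ H, IsSplit s t V E H m m₀ ∧ deg s t H z = r := by
    intro hnt z hz
    obtain ⟨w, hw, hwz⟩ := hnt.exists_ne z
    have hzV := hmem.2 hz
    have hdeg : 2 * (m + m₀) ≤ deg s t E₀ z := by
      have h1 := sum_deg s t E₀ {z}
      have h2 : crossing s t E₀ {z} = crossing s t E₀ (V.erase z) := by
        refine Finset.filter_congr fun e he => ?_
        have := hE₀V e he
        simp only [Finset.mem_singleton, Finset.mem_erase]
        tauto
      have h3 := hcut z hzV (V.erase z) (Finset.erase_subset _ _) (by simp)
        ⟨w, Finset.mem_erase.2 ⟨hwz, hmem.2 hw⟩⟩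
      rw [Finset.sum_singleton, h2] at h1
      omega
    have := exists_isSplit_union_loops_eq (V := V) hm (by omega) (fun r hr hr' =>
      exists_isSplit_of_loopless hm hzV (hmem.2 hw) hwz hE₀V
        (fun e he => (Finset.mem_filter.1 he).2) (hcut z hzV) hr hr') L hLl hdis
    rw [hLE] at this
    refine ⟨?_, this⟩
    rw [← hLE, deg_union hdis]
    omega
  refine ⟨?_, fun hnt z hz r hr hr' => ?_⟩
  · suffices H : ∃ H, IsSplit s t V E H m m₀ from
      H.imp' _ fun H hH => hH.isBoundedTreeConnectedFactor hVV.symm hEE.symm hp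
    by_cases hnt : V(G).Nontrivial
    · obtain ⟨H, hH, -⟩ := (hvalue hnt v₀ hv₀).2 (deg s t E v₀ / 2) (by omega) (by omega)
      exact ⟨H, hH⟩
    · have hV₁ : V = {v₀} := by
        refine Finset.eq_singleton_iff_unique_mem.2 ⟨hmem.2 hv₀, fun x hx => ?_⟩
        exact Set.not_nontrivial_iff.1 hnt (hmem.1 hx) hv₀
      have hE₁ : E₀ = ∅ := Finset.filter_eq_empty_iff.2 fun e he => by
        have h := hp e he
        have h1 := hmem.2 h.left_mem
        have h2 := hmem.2 h.right_mem
        rw [hV₁, Finset.mem_singleton] at h1 h2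
        exact not_not.2 (h1.trans h2.symm)
      have := exists_isSplit_union_loops (V := V) hm
        ⟨∅, by rw [hE₁, hV₁]; exact isSplit_empty v₀ m m₀⟩ L hLl hdis
      rwa [hLE] at this
  · rw [hGE, floor_half] at hr
    rw [hGE, ceil_half] at hr'
    obtain ⟨hd, hsplit⟩ := hvalue hnt z hz
    obtain ⟨H, hH, hHr⟩ := hsplit r.toNat (by omega) (by omega)
    refine ⟨_, hH.isBoundedTreeConnectedFactor hVV.symm hEE.symm hp, ?_⟩
    rw [degree_restrict fun e he => hp e (hH.subset he)]
    change (deg s t H z : ℤ) = r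
    omega
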